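/- Let $\mathbb{S}^2=\mathrm{Spec}\,\mathbb{R}[x,y,z]/(x^2+y^2+z^2-1)$. For a real algebraic variety $X$ let $X_{\mathbb C}=X\times_{\mathrm{Spec}\,\mathbb R}\mathrm{Spec}\,\mathbb C$ be its complexification and $\sigma_X=\mathrm{id}_X\times\tau$ its canonical real structure, where $\tau$ is complex conjugation on $\mathrm{Spec}\,\mathbb C$. A real structure on a complex variety $f:V\to\mathrm{Spec}\,\mathbb C$ is a morphism of schemes $\sigma:V\to V$ with $f\circ\sigma=\tau\circ f$ and $\sigma^2=\mathrm{id}_V$. The map $([x_0:x_1],[y_0:y_1])\mapsto[x_0y_1+x_1y_0:i(x_1y_0-x_0y_1):x_0y_0-x_1y_1:x_0y_0+x_1y_1]$ identifies $\mathbb P^1_{\mathbb C}\times\mathbb P^1_{\mathbb C}$ with the complexification of the real quadric $\{X^2+Y^2+Z^2=T^2\}\subset\mathbb P^3_{\mathbb R}$, and it identifies the open subset $\{x_0y_0+x_1y_1\neq0\}$ with $\mathbb S^2_{\mathbb C}=\{T\ne0\}$. For $n\ge 0$ let $L_n$ be the restriction to $\mathbb S^2_{\mathbb C}$ of the line bundle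 $\mathrm{pr}_1^*\mathcal O_{\mathbb P^1_{\mathbb C}}(n)$, and let $q_n:V_n\to\mathbb S^2$ be the real algebraic vector bundle of rank $2$ obtained by Galois descent from $L_n\oplus\sigma_{\mathbb S^2}^*L_n$ with the real structure that lifts $\sigma_{\mathbb S^2}$ and exchanges the two summands. Let $n\geq1$ and let $P_n,Q_n\in\mathbb R[z]$ be any polynomials such that $$(1+z)^nP_n(z)+(1-z)^nQ_n(z)=1 .$$ Then the following hold. a) The matrix $$A_n=\begin{pmatrix}(x-iy)^n(P_n+Q_n) & (1-z)^n-(1+z)^n\\ -(1+z)^nP_n^2+(1-z)^nQ_n^2 & -(x+iy)^n(P_n+Q_n)\end{pmatrix}$$ belongs to $\mathrm{GL}_2(\Gamma(\mathbb S^2_{\mathbb C},\mathcal O_{\mathbb S^2_{\mathbb C}}))$. Let $\Sigma_0=\sigma_{\mathbb S^2}\times\sigma_{\mathbb A^2_{\mathbb R}}$ be the canonical product real structure on $\mathbb S^2_{\mathbb C}\times\mathbb A^2_{\mathbb C}$, and let $j_n:(p,v)\mapsto(p,A_n(p)v)$ be the automorphism of the trivial bundle $\mathbb S^2_{\mathbb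 C}\times\mathbb A^2_{\mathbb C}$ defined by $A_n$. Then $\Sigma_n=j_n\circ\Sigma_0$ is a real structure on $\mathbb S^2_{\mathbb C}\times\mathbb A^2_{\mathbb C}$. b) There exists an isomorphism $\Theta_n:V_{n,\mathbb C}\to\mathbb S^2_{\mathbb C}\times\mathbb A^2_{\mathbb C}$ of vector bundles over $\mathbb S^2_{\mathbb C}$ such that $\Sigma_n\circ\Theta_n=\Theta_n\circ\sigma_{V_n}$, where $\sigma_{V_n}$ denotes the canonical real structure on $V_{n,\mathbb C}$. -/

import Mathlib

open CategoryTheory CategoryTheory.Limits AlgebraicGeometry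
open scoped TensorProduct

noncomputable section

namespace RealSphere

/-! ## Complexification and real structures -/

/-- The morphism `c : Spec ℂ ⟶ Spec ℝ` induced by the inclusion `ℝ ⊆ ℂ`. -/
def specC : Spec (.of ℂ) ⟶ Spec (.of ℝ) :=
  Spec.map (CommRingCat.ofHom (algebraMap ℝ ℂ))

/-- Complex conjugation `τ : Spec ℂ ⟶ Spec ℂ`. -/
def specConj : Spec (.of ℂ) ⟶ Spec (.of ℂ) :=
  Spec.map (CommRingCat.ofHom (starRingEnd ℂ))

lemma specConj_comp_specC : specConj ≫ specC = specC := by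
  unfold specConj specC
  rw [← Spec.map_comp, ← CommRingCat.ofHom_comp]
  congr 2
  ext x
  exact Complex.conj_ofReal x

/-- The complexification `X_ℂ = X ×_{Spec ℝ} Spec ℂ` of a real scheme `f : X ⟶ Spec ℝ`. -/
abbrev Cpx {X : Scheme.{0}} (f : X ⟶ Spec (.of ℝ)) : Scheme.{0} := pullback f specC

/-- The projection `X_ℂ ⟶ X`. -/
abbrev cpxFst {X : Scheme.{0}} (f : X ⟶ Spec (.of ℝ)) : Cpx f ⟶ X := pullback.fst f specC

/-- The structure morphism `X_ℂ ⟶ Spec ℂ`. -/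
abbrev cpxSnd {X : Scheme.{0}} (f : X ⟶ Spec (.of ℝ)) : Cpx f ⟶ Spec (.of ℂ) :=
  pullback.snd f specC

/-- The canonical real structure `σ_X = id_X × τ` on `X_ℂ`. -/
def canonicalReal {X : Scheme.{0}} (f : X ⟶ Spec (.of ℝ)) : Cpx f ⟶ Cpx f :=
  pullback.lift (cpxFst f) (cpxSnd f ≫ specConj)
    (by rw [Category.assoc, specConj_comp_specC]; exact pullback.condition)

/-- The complexification of a morphism `q : Y ⟶ X` of real schemes. -/
def cpxMap {X Y : Scheme.{0}} (q : Y ⟶ X) (f : X ⟶ Spec (.of ℝ)) : Cpx (q ≫ f) ⟶ Cpx f :=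
  pullback.lift (cpxFst (q ≫ f) ≫ q) (cpxSnd (q ≫ f))
    (by rw [Category.assoc]; exact pullback.condition)

/-- A real structure on a complex scheme `f : V ⟶ Spec ℂ`: a morphism `σ : V ⟶ V` with
`f ∘ σ = τ ∘ f` and `σ² = id`. -/
structure IsRealStructure {V : Scheme.{0}} (f : V ⟶ Spec (.of ℂ)) (σ : V ⟶ V) : Prop where
  anti : σ ≫ f = f ≫ specConj
  invol : σ ≫ σ = 𝟙 V

/-! ## The real two-sphere -/

/-- The equation `x² + y² + z² - 1`. -/
def sphereEq : MvPolynomial (Fin 3) ℝ :=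
  MvPolynomial.X 0 ^ 2 + MvPolynomial.X 1 ^ 2 + MvPolynomial.X 2 ^ 2 - 1

/-- The coordinate ring `ℝ[x, y, z] / (x² + y² + z² - 1)` of `𝕊²`. -/
abbrev SphereRing : Type := MvPolynomial (Fin 3) ℝ ⧸ Ideal.span {sphereEq}

/-- The classes of `x`, `y`, `z` in the coordinate ring. -/
def sphereCoord (i : Fin 3) : SphereRing := Ideal.Quotient.mk _ (MvPolynomial.X i)

/-- The structure morphism of the real affine variety `𝕊² = Spec SphereRing`. -/
def sphereHom : Spec (.of SphereRing) ⟶ Spec (.of ℝ) :=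
  Spec.map (CommRingCat.ofHom (algebraMap ℝ SphereRing))

/-- The complexification `𝕊²_ℂ`. -/
abbrev SphereC : Scheme.{0} := Cpx sphereHom

/-- The pull-back `Γ(𝕊², 𝒪) → Γ(𝕊²_ℂ, 𝒪)` of regular functions. -/
def sphereFun : SphereRing →+* Γ(SphereC, ⊤) :=
  (cpxFst sphereHom).appTop.hom.comp (Scheme.ΓSpecIso (.of SphereRing)).inv.hom

/-- The constant function `i` on `𝕊²_ℂ`. -/
def imagUnit : Γ(SphereC, ⊤) :=
  (cpxSnd sphereHom).appTop.hom ((Scheme.ΓSpecIso (.of ℂ)).inv.hom Complex.I)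

/-! ## Geometric vector bundles -/

/-- For `p : V ⟶ X` and a set `S` of regular functions on `V`, the `Γ(X, 𝒪)`-submodule of
`Γ(V, 𝒪)` generated by `S`. -/
def linSpan {V X : Scheme.{0}} (p : V ⟶ X) (S : Set Γ(V, ⊤)) : AddSubgroup Γ(V, ⊤) :=
  AddSubgroup.closure {g | ∃ a : Γ(X, ⊤), ∃ s ∈ S, g = p.appTop.hom a * s}

/-- Let `p : V ⟶ X` and `q : W ⟶ X` be vector bundles over an affine scheme `X`, with modules
`LV` and `LW` of fibrewise linear regular functions. An isomorphism `Θ : V ≅ W` of schemes is an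
isomorphism of vector bundles when it is over `X` and it is linear on the fibres, that is, it
and its inverse pull fibrewise linear functions back to fibrewise linear functions. -/
structure IsBundleIso {X V W : Scheme.{0}} (p : V ⟶ X) (q : W ⟶ X)
    (LV : AddSubgroup Γ(V, ⊤)) (LW : AddSubgroup Γ(W, ⊤)) (Θ : V ≅ W) : Prop where
  isOver : Θ.hom ≫ q = p
  hom_linear : ∀ g ∈ LW, Θ.hom.appTop.hom g ∈ LV
  inv_linear : ∀ g ∈ LV, Θ.inv.appTop.hom g ∈ LW

/-- The trivial bundle `X × 𝔸²`. Over a complex scheme `X` this is `X ×_{Spec ℂ} 𝔸²_ℂ`. -/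
abbrev Triv (X : Scheme.{0}) : Scheme.{0} := 𝔸(Fin 2; X)

/-- The projection of the trivial bundle. -/
abbrev trivProj (X : Scheme.{0}) : Triv X ⟶ X := Triv X ↘ X

/-- The fibrewise linear functions on the trivial bundle, generated by its two coordinates. -/
def trivLinear (X : Scheme.{0}) : AddSubgroup Γ(Triv X, ⊤) :=
  linSpan (trivProj X) (Set.range (AffineSpace.coord X))

/-- The fibrewise linear endomorphism `(p, v) ↦ (p, A(p) v)` of the trivial bundle. -/
def matrixEnd {X : Scheme.{0}} (A : Matrix (Fin 2) (Fin 2) Γ(X, ⊤)) : Triv X ⟶ Triv X :=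
  AffineSpace.homOfVector (trivProj X)
    (fun j => ∑ k, (trivProj X).appTop.hom (A j k) * AffineSpace.coord X k)

/-- The geometric vector bundle `Spec (Sym N^∨)` of a finitely generated projective
`B`-module `N`, whose sections form the module `N`. -/
abbrev BundleOf (B N : Type) [CommRing B] [AddCommMonoid N] [Module B N] : Scheme.{0} :=
  Spec (.of (SymmetricAlgebra B (Module.Dual B N)))

/-- The projection of the geometric vector bundle of `N`. -/
def bundleProj (B N : Type) [CommRing B] [AddCommMonoid N] [Module B N] :
    BundleOf B N ⟶ Spec (.of B) :=
  Spec.map (CommRingCat.ofHom (algebraMap B (SymmetricAlgebra B (Module.Dual B N))))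

/-- The regular function on the geometric vector bundle of `N` given by an element of `N^∨`. -/
def bundleForm (B N : Type) [CommRing B] [AddCommMonoid N] [Module B N] (l : Module.Dual B N) :
    Γ(BundleOf B N, ⊤) :=
  (Scheme.ΓSpecIso (.of (SymmetricAlgebra B (Module.Dual B N)))).inv.hom
    (SymmetricAlgebra.ι B (Module.Dual B N) l)

/-! ## Galois descent of `E ⊕ σ^* E` over an affine real scheme `X = Spec B` -/

/-- The coordinate ring `B ⊗_ℝ ℂ` of `X_ℂ`. -/
abbrev CpxRing (B : Type) [CommRing B] [Algebra ℝ B] : Type := B ⊗[ℝ] ℂ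

/-- The comorphism `id ⊗ conj` of the canonical real structure `σ_X`. -/
def ringConj (B : Type) [CommRing B] [Algebra ℝ B] : CpxRing B →ₐ[B] CpxRing B :=
  Algebra.TensorProduct.map (AlgHom.id B B) Complex.conjAe.toAlgHom

lemma ringConj_algebraMap (B : Type) [CommRing B] [Algebra ℝ B] (b : B) :
    ringConj B (algebraMap B (CpxRing B) b) = algebraMap B (CpxRing B) b :=
  (ringConj B).commutes b

/-- The module `σ_X^* M` of a module `M` over the coordinate ring of `X_ℂ`: since `σ_X` is an involution, this is the additive
group `M` on which a scalar acts through its conjugate. -/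
def ConjTwist (B M : Type) [CommRing B] [Algebra ℝ B] : Type := M

instance (B M : Type) [CommRing B] [Algebra ℝ B] [AddCommGroup M] :
    AddCommGroup (ConjTwist B M) := inferInstanceAs (AddCommGroup M)

instance (B M : Type) [CommRing B] [Algebra ℝ B] [AddCommGroup M] [Module (CpxRing B) M] :
    Module (CpxRing B) (ConjTwist B M) :=
  (Module.compHom M (ringConj B).toRingHom : Module (CpxRing B) M)

/-- The identity map from `M` to `σ_X^* M`; it is additive, and semilinear over `σ_X`. -/
def toTwist (B M : Type) [CommRing B] [Algebra ℝ B] [AddCommGroup M] : M ≃+ ConjTwist B M :=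
  AddEquiv.refl M

section Descent

variable (B M : Type) [CommRing B] [Algebra ℝ B] [AddCommGroup M] [Module (CpxRing B) M]

lemma smul_toTwist (a : CpxRing B) (m : M) :
    a • toTwist B M m = toTwist B M (ringConj B a • m) := rfl

/-- The involution of `M ⊕ σ_X^* M` that exchanges the two summands. -/
def swapInvol (v : M × ConjTwist B M) : M × ConjTwist B M :=
  ((toTwist B M).symm v.2, toTwist B M v.1)

/-- The involution is semilinear over `σ_X`. -/
lemma swapInvol_smul (a : CpxRing B) (v : M × ConjTwist B M) :
    swapInvol B M (ringConj B a • v) = a • swapInvol B M v := by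
  have h : ringConj B (ringConj B a) = a := by
    induction a using TensorProduct.induction_on with
    | zero => simp
    | tmul b c => simp [ringConj]
    | add s t hs ht => simp only [map_add, hs, ht]
  refine Prod.ext ?_ rfl
  change ringConj B (ringConj B a) • (toTwist B M).symm v.2 = a • (toTwist B M).symm v.2
  rw [h]

/-- The `B`-module descended from `M ⊕ σ_X^* M`, namely the invariants of the involution. -/
def descent : Submodule B (RestrictScalars B (CpxRing B) (M × ConjTwist B M)) where
  carrier := {v | swapInvol B M v = v}
  add_mem' := by
    intro v w hv hw
    exact congrArg₂ (fun a b : M × ConjTwist B M => a + b) hv hw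
  zero_mem' := rfl
  smul_mem' := by
    intro b v hv
    have h := swapInvol_smul B M (algebraMap B (CpxRing B) b) v
    rw [ringConj_algebraMap] at h
    exact h.trans (congrArg
      (fun w : M × ConjTwist B M => algebraMap B (CpxRing B) b • w) hv)

end Descent

/-! ## The line bundles `pr₁^* 𝒪(n)` on `ℙ¹_ℂ × ℙ¹_ℂ`, restricted to the sphere

The variables `Sum.inl i` are the homogeneous coordinates `x_i` of the first factor, the variables
`Sum.inr i` the homogeneous coordinates `y_i` of the second. -/

/-- The bihomogeneous coordinate ring `ℂ[x₀, x₁, y₀, y₁]` of `ℙ¹_ℂ × ℙ¹_ℂ`. -/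
abbrev BiRing : Type := MvPolynomial (Fin 2 ⊕ Fin 2) ℂ

/-- The bidegrees of the variables. -/
def biWeight : Fin 2 ⊕ Fin 2 → ℕ × ℕ := Sum.elim (fun _ => (1, 0)) (fun _ => (0, 1))

/-- The variable `x_i`. -/
def xv (i : Fin 2) : BiRing := MvPolynomial.X (Sum.inl i)

/-- The variable `y_i`. -/
def yv (i : Fin 2) : BiRing := MvPolynomial.X (Sum.inr i)

/-- The form `T = x₀ y₀ + x₁ y₁`, whose zero locus is the curve at infinity of the sphere. -/
def quadT : BiRing := xv 0 * yv 0 + xv 1 * yv 1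

/-- The forms `X = x₀ y₁ + x₁ y₀`, `Y = i (x₁ y₀ - x₀ y₁)`, `Z = x₀ y₀ - x₁ y₁` that define,
with `T`, the isomorphism of `ℙ¹_ℂ × ℙ¹_ℂ` onto the quadric `X² + Y² + Z² = T²`. -/
def quadXYZ : Fin 3 → BiRing :=
  ![xv 0 * yv 1 + xv 1 * yv 0,
    MvPolynomial.C Complex.I * (xv 1 * yv 0 - xv 0 * yv 1),
    xv 0 * yv 0 - xv 1 * yv 1]

lemma quad_relation :
    quadXYZ 0 ^ 2 + quadXYZ 1 ^ 2 + quadXYZ 2 ^ 2 = quadT ^ 2 := by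
  have hI : (MvPolynomial.C Complex.I : BiRing) ^ 2 = -1 := by
    rw [← map_pow, Complex.I_sq, map_neg, map_one]
  simp only [quadXYZ, quadT, Matrix.cons_val_zero, Matrix.cons_val_one, Matrix.cons_val]
  rw [mul_pow, hI]
  ring

/-- The localization of the bihomogeneous coordinate ring at `T`. -/
abbrev BiLoc : Type := Localization.Away quadT

/-- The inverse of `T`. -/
abbrev invT : BiLoc := IsLocalization.Away.invSelf quadT

lemma quadT_mul_invT : algebraMap BiRing BiLoc quadT * invT = 1 :=
  IsLocalization.Away.mul_invSelf quadT

/-- The comorphism `x ↦ X / T`, `y ↦ Y / T`, `z ↦ Z / T` on polynomials. -/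
def polyPull : MvPolynomial (Fin 3) ℝ →ₐ[ℝ] BiLoc :=
  MvPolynomial.aeval (fun i => algebraMap BiRing BiLoc (quadXYZ i) * invT)

lemma polyPull_sphereEq : polyPull sphereEq = 0 := by
  have h := congrArg (algebraMap BiRing BiLoc) quad_relation
  have hT := quadT_mul_invT
  simp only [map_add, map_pow] at h
  simp only [polyPull, sphereEq, map_add, map_sub, map_pow, map_one, MvPolynomial.aeval_X]
  rw [mul_pow, mul_pow, mul_pow, ← add_mul, ← add_mul, h, ← mul_pow, hT, one_pow, sub_self]

/-- The comorphism `Γ(𝕊², 𝒪) → ℂ[x₀, x₁, y₀, y₁]_T`. -/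
def spherePull : SphereRing →ₐ[ℝ] BiLoc :=
  Ideal.Quotient.liftₐ (Ideal.span {sphereEq}) polyPull (by
    intro a ha
    obtain ⟨b, rfl⟩ := Ideal.mem_span_singleton'.mp ha
    rw [map_mul, polyPull_sphereEq, mul_zero])

/-- The comorphism `Γ(𝕊²_ℂ, 𝒪) → ℂ[x₀, x₁, y₀, y₁]_T` of the isomorphism of
`(ℙ¹_ℂ × ℙ¹_ℂ) ∖ {T = 0}` onto `𝕊²_ℂ`; its image is the part of bidegree `(0, 0)`. -/
def quadPull : CpxRing SphereRing →ₐ[ℝ] BiLoc :=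
  Algebra.TensorProduct.lift spherePull (IsScalarTower.toAlgHom ℝ ℂ BiLoc)
    (fun _ _ => Commute.all _ _)

instance : Algebra (CpxRing SphereRing) BiLoc := quadPull.toRingHom.toAlgebra

/-- `t` is homogeneous of bidegree `(a, b)`, that is, `t = f / T^k` with `f` a bihomogeneous
polynomial of bidegree `(a + k, b + k)`. -/
def IsBihom (a b : ℕ) (t : BiLoc) : Prop :=
  ∃ (k : ℕ) (f : BiRing), f.IsWeightedHomogeneous biWeight (a + k, b + k) ∧
    t = algebraMap BiRing BiLoc f * invT ^ k

lemma xv_bihom (i : Fin 2) : (xv i).IsWeightedHomogeneous biWeight (1, 0) :=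
  MvPolynomial.isWeightedHomogeneous_X ℂ biWeight (Sum.inl i)

lemma yv_bihom (i : Fin 2) : (yv i).IsWeightedHomogeneous biWeight (0, 1) :=
  MvPolynomial.isWeightedHomogeneous_X ℂ biWeight (Sum.inr i)

lemma xy_bihom (i j : Fin 2) : (xv i * yv j).IsWeightedHomogeneous biWeight (1, 1) :=
  (xv_bihom i).mul (yv_bihom j)

lemma quadT_bihom : quadT.IsWeightedHomogeneous biWeight (1, 1) :=
  (xy_bihom 0 0).add (xy_bihom 1 1)

lemma bihom_sub {f g : BiRing} {d : ℕ × ℕ} (hf : f.IsWeightedHomogeneous biWeight d)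
    (hg : g.IsWeightedHomogeneous biWeight d) : (f - g).IsWeightedHomogeneous biWeight d :=
  (MvPolynomial.weightedHomogeneousSubmodule ℂ biWeight d).sub_mem hf hg

lemma quadXYZ_bihom (i : Fin 3) : (quadXYZ i).IsWeightedHomogeneous biWeight (1, 1) := by
  fin_cases i
  · exact (xy_bihom 0 1).add (xy_bihom 1 0)
  · have := (MvPolynomial.isWeightedHomogeneous_C biWeight Complex.I).mul
      (bihom_sub (xy_bihom 1 0) (xy_bihom 0 1))
    rwa [zero_add] at this
  · exact bihom_sub (xy_bihom 0 0) (xy_bihom 1 1)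

lemma IsBihom.raise {a b k : ℕ} {f : BiRing}
    (hf : f.IsWeightedHomogeneous biWeight (a + k, b + k)) (m : ℕ) :
    (f * quadT ^ m).IsWeightedHomogeneous biWeight (a + (k + m), b + (k + m)) ∧
    algebraMap BiRing BiLoc f * invT ^ k =
      algebraMap BiRing BiLoc (f * quadT ^ m) * invT ^ (k + m) := by
  constructor
  · have := hf.mul (quadT_bihom.pow m)
    convert this using 1
    ext <;> simp [add_assoc]
  · have h : (algebraMap BiRing BiLoc quadT) ^ m * invT ^ m = 1 := by
      rw [← mul_pow, quadT_mul_invT, one_pow]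
    rw [map_mul, map_pow, pow_add]
    linear_combination (-(algebraMap BiRing BiLoc f * invT ^ k)) * h

lemma IsBihom.zero (a b : ℕ) : IsBihom a b 0 :=
  ⟨0, 0, MvPolynomial.isWeightedHomogeneous_zero ℂ biWeight _, by simp⟩

lemma IsBihom.add {a b : ℕ} {s t : BiLoc} (hs : IsBihom a b s) (ht : IsBihom a b t) :
    IsBihom a b (s + t) := by
  obtain ⟨k, f, hf, rfl⟩ := hs
  obtain ⟨l, g, hg, rfl⟩ := ht
  obtain ⟨h1, e1⟩ := IsBihom.raise hf l
  obtain ⟨h2, e2⟩ := IsBihom.raise hg k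
  rw [add_comm l k] at h2 e2
  exact ⟨k + l, _, h1.add h2, by rw [e1, e2, map_add, add_mul]⟩

lemma IsBihom.mul {a b c d : ℕ} {s t : BiLoc} (hs : IsBihom a b s) (ht : IsBihom c d t) :
    IsBihom (a + c) (b + d) (s * t) := by
  obtain ⟨k, f, hf, rfl⟩ := hs
  obtain ⟨l, g, hg, rfl⟩ := ht
  refine ⟨k + l, f * g, ?_, by rw [map_mul, pow_add]; ring⟩
  convert hf.mul hg using 1
  ext <;> simp <;> ring

lemma IsBihom.const (c : ℂ) : IsBihom 0 0 (algebraMap ℂ BiLoc c) :=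
  ⟨0, MvPolynomial.C c, by simpa using! MvPolynomial.isWeightedHomogeneous_C biWeight c, by
    rw [pow_zero, mul_one, IsScalarTower.algebraMap_apply ℂ BiRing BiLoc]; rfl⟩

lemma polyPull_bihom (p : MvPolynomial (Fin 3) ℝ) : IsBihom 0 0 (polyPull p) := by
  induction p using MvPolynomial.induction_on with
  | C r =>
    have : polyPull (MvPolynomial.C r) = algebraMap ℂ BiLoc (r : ℂ) := by
      rw [polyPull, MvPolynomial.aeval_C, IsScalarTower.algebraMap_apply ℝ ℂ BiLoc]; rfl
    rw [this]
    exact IsBihom.const _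
  | add p q hp hq => rw [map_add]; exact hp.add hq
  | mul_X p i hp =>
    rw [map_mul]
    refine hp.mul ⟨1, quadXYZ i, by simpa using quadXYZ_bihom i, ?_⟩
    rw [polyPull, MvPolynomial.aeval_X, pow_one]

lemma quadPull_bihom (a : CpxRing SphereRing) : IsBihom 0 0 (quadPull a) := by
  induction a using TensorProduct.induction_on with
  | zero => rw [map_zero]; exact IsBihom.zero 0 0
  | tmul s c =>
    obtain ⟨p, rfl⟩ := Ideal.Quotient.mk_surjective s
    have : quadPull (Ideal.Quotient.mk _ p ⊗ₜ[ℝ] c) = polyPull p * algebraMap ℂ BiLoc c := by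
      rw [quadPull, Algebra.TensorProduct.lift_tmul]; rfl
    rw [this]
    exact (polyPull_bihom p).mul (IsBihom.const c)
  | add s t hs ht => rw [map_add]; exact hs.add ht

/-- The `Γ(𝕊²_ℂ, 𝒪)`-module of sections over `𝕊²_ℂ = (ℙ¹_ℂ × ℙ¹_ℂ) ∖ {T = 0}` of the line bundle
`L_n = pr₁^* 𝒪(n) = 𝒪(n, 0)`: the part of bidegree `(n, 0)` of `ℂ[x₀, x₁, y₀, y₁]_T`. -/
def lineSections (n : ℕ) : Submodule (CpxRing SphereRing) BiLoc where
  carrier := {t | IsBihom n 0 t}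
  add_mem' := IsBihom.add
  zero_mem' := IsBihom.zero n 0
  smul_mem' := by
    intro a t ht
    have h := (quadPull_bihom a).mul ht
    rw [zero_add, zero_add] at h
    exact h

/-! ## The real vector bundles `V_n` and the real structures `Σ_n` -/

/-- The `Γ(𝕊², 𝒪)`-module of sections of `V_n`, descended from `L_n ⊕ σ^* L_n`. -/
abbrev VSections (n : ℕ) : Type := descent SphereRing (lineSections n)

/-- The total space of the real vector bundle `V_n`. -/
abbrev V (n : ℕ) : Scheme.{0} := BundleOf SphereRing (VSections n)

/-- The projection `q_n : V_n ⟶ 𝕊²`. -/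
abbrev q (n : ℕ) : V n ⟶ Spec (.of SphereRing) := bundleProj SphereRing (VSections n)

/-- The complexification `V_{n,ℂ}`. -/
abbrev VC (n : ℕ) : Scheme.{0} := Cpx (q n ≫ sphereHom)

/-- The projection `q_{n,ℂ} : V_{n,ℂ} ⟶ 𝕊²_ℂ`. -/
abbrev qC (n : ℕ) : VC n ⟶ SphereC := cpxMap (q n) sphereHom

/-- The fibrewise linear functions on `V_{n,ℂ}`, generated over `Γ(𝕊²_ℂ, 𝒪)` by those on `V_n`. -/
def VCLinear (n : ℕ) : AddSubgroup Γ(VC n, ⊤) :=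
  linSpan (qC n) (Set.range fun l : Module.Dual SphereRing (VSections n) =>
    (cpxFst (q n ≫ sphereHom)).appTop.hom (bundleForm SphereRing (VSections n) l))

/-- The canonical real structure on `V_{n,ℂ}`. -/
abbrev sigmaV (n : ℕ) : VC n ⟶ VC n := canonicalReal (q n ≫ sphereHom)

/-- The matrix `A_n` with entries in `Γ(𝕊²_ℂ, 𝒪)` attached to polynomials `P`, `Q`. -/
def matA (n : ℕ) (P Q : Polynomial ℝ) : Matrix (Fin 2) (Fin 2) Γ(SphereC, ⊤) :=
  let x := sphereFun (sphereCoord 0)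
  let y := sphereFun (sphereCoord 1)
  let z := sphereFun (sphereCoord 2)
  let p := sphereFun (Polynomial.aeval (sphereCoord 2) P)
  let r := sphereFun (Polynomial.aeval (sphereCoord 2) Q)
  !![(x - imagUnit * y) ^ n * (p + r), (1 - z) ^ n - (1 + z) ^ n;
     -((1 + z) ^ n * p ^ 2) + (1 - z) ^ n * r ^ 2, -((x + imagUnit * y) ^ n * (p + r))]

/-- The structure morphism of the complex variety `𝕊²_ℂ × 𝔸²_ℂ`. -/
abbrev trivHom : Triv SphereC ⟶ Spec (.of ℂ) := trivProj SphereC ≫ cpxSnd sphereHom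

/-- The product real structure `Σ₀` on `𝕊²_ℂ × 𝔸²_ℂ`: it is `σ_{𝕊²}` on the base and fixes the two
coordinate functions of `𝔸²`. -/
def Sigma0 : Triv SphereC ⟶ Triv SphereC :=
  AffineSpace.map (Fin 2) (canonicalReal sphereHom)

/-- The composition `Σ_n = j_n ∘ Σ₀`, where `j_n` is the bundle endomorphism with matrix `A_n`. -/
def SigmaN (n : ℕ) (P Q : Polynomial ℝ) : Triv SphereC ⟶ Triv SphereC :=
  Sigma0 ≫ matrixEnd (matA n P Q)

end RealSphere

end

/-! Write `B` for the coordinate ring of the sphere and `M` for the sections of `L_n`. An invariant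
of the exchange involution is determined by its first component, so the module of sections of `V_n`
is `M` with scalars restricted to `B`. Its complex valued `B`-linear forms split into linear and
antilinear ones, that is, into the dual of `L_n` and the dual of its conjugate. Conjugation of the
values is the canonical real structure, and trivializing `V_{n,ℂ}` amounts to finding a basis of
these forms.

On the sphere the conjugate of `𝒪(n,0)` is `𝒪(0,n)`, and `𝒪(n,n)` is trivialized by `T^n`. The
sections `s_i = x_i^n` and the forms `g_j = (2 y_j)^n / T^n` pair to the `n`-th powers of the
entries of the hermitian matrix `(1+z, x+iy; x-iy, 1-z)`, which has rank one by the equation of the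
sphere. Put `c = (P, Q)`. The hypothesis on `P` and `Q` says that `c_0 g_0(s_0) + c_1 g_1(s_1) = 1`.
Up to sign this is the determinant of the two forms `g_0 + conj g_1` and `c_1 g_1 - c_0 conj g_0`
with respect to the linear and antilinear summands, so they are a basis. Conjugating them and
expanding the result in the same basis gives the conjugate of `A_n`. This is what compatibility
demands, because pull-back by `Σ₀` conjugates the matrix entries.

The algebra is carried by `quadPull_injective` and `mem_range_quadPull`, which identify the
coordinate ring of the complex sphere with the part of bidegree `(0,0)`, and by
`HermitianPair.two_mul_form`, `HermitianPair.coef_frame`, `HermitianPair.conj_frame_zero` and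
`HermitianPair.conj_frame_one`. The passage to schemes is `frameIso` and `frameHom_comp_matrixEnd`.
Part a) reduces to `conj_matA_mul_matA`: the product of the conjugate of `A_n` with `A_n` is the
identity. -/

noncomputable section

namespace RealSphere

/-! ### Real and imaginary parts in `B ⊗_ℝ ℂ`, and homomorphisms out of it -/

section Complexification

variable (B : Type) [CommRing B] [Algebra ℝ B]

/-- The imaginary unit of `B ⊗_ℝ ℂ`. -/
def cpxI : CpxRing B := 1 ⊗ₜ[ℝ] Complex.I

lemma cpxI_mul_cpxI : cpxI B * cpxI B = -1 := by
  rw [cpxI, Algebra.TensorProduct.tmul_mul_tmul, Complex.I_mul_I, TensorProduct.tmul_neg, mul_one]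
  rfl

lemma ringConj_cpxI : ringConj B (cpxI B) = -cpxI B := by
  simp [ringConj, cpxI, TensorProduct.tmul_neg]

lemma ringConj_ringConj (a : CpxRing B) : ringConj B (ringConj B a) = a := by
  induction a using TensorProduct.induction_on with
  | zero => simp
  | tmul b c => simp [ringConj]
  | add s t hs ht => simp only [map_add, hs, ht]

/-- The real part `B ⊗_ℝ ℂ → B`. -/
def cpxRe : CpxRing B →ₗ[B] B :=
  (TensorProduct.AlgebraTensorModule.rid ℝ B B).toLinearMap ∘ₗ
    TensorProduct.AlgebraTensorModule.lTensor B B Complex.reLm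

/-- The imaginary part `B ⊗_ℝ ℂ → B`. -/
def cpxIm : CpxRing B →ₗ[B] B :=
  (TensorProduct.AlgebraTensorModule.rid ℝ B B).toLinearMap ∘ₗ
    TensorProduct.AlgebraTensorModule.lTensor B B Complex.imLm

lemma cpxRe_tmul (b : B) (c : ℂ) : cpxRe B (b ⊗ₜ[ℝ] c) = c.re • b := by
  simp [cpxRe]

lemma cpxIm_tmul (b : B) (c : ℂ) : cpxIm B (b ⊗ₜ[ℝ] c) = c.im • b := by
  simp [cpxIm]

lemma cpxRe_add_cpxIm (a : CpxRing B) :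
    algebraMap B (CpxRing B) (cpxRe B a) + cpxI B * algebraMap B (CpxRing B) (cpxIm B a) = a := by
  induction a using TensorProduct.induction_on with
  | zero => simp
  | tmul b c =>
    rw [cpxRe_tmul, cpxIm_tmul, cpxI, Algebra.TensorProduct.algebraMap_apply,
      Algebra.TensorProduct.algebraMap_apply, Algebra.TensorProduct.tmul_mul_tmul]
    simp only [Algebra.algebraMap_self, RingHom.id_apply, one_mul, mul_one,
      TensorProduct.smul_tmul, ← TensorProduct.tmul_add]
    congr 1
    apply Complex.ext <;> simp
  | add s t hs ht =>
    rw [map_add, map_add, map_add, map_add, mul_add]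
    linear_combination hs + ht

lemma cpxRe_algebraMap (b : B) : cpxRe B (algebraMap B (CpxRing B) b) = b := by
  rw [Algebra.TensorProduct.algebraMap_apply, cpxRe_tmul]; simp

lemma cpxIm_algebraMap (b : B) : cpxIm B (algebraMap B (CpxRing B) b) = 0 := by
  rw [Algebra.TensorProduct.algebraMap_apply, cpxIm_tmul]; simp

lemma cpxRe_cpxI_mul (a : CpxRing B) : cpxRe B (cpxI B * a) = -cpxIm B a := by
  induction a using TensorProduct.induction_on with
  | zero => simp
  | tmul b c =>
    rw [cpxI, Algebra.TensorProduct.tmul_mul_tmul, cpxRe_tmul, cpxIm_tmul]; simp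
  | add s t hs ht => rw [mul_add, map_add, map_add, hs, ht, neg_add]

lemma cpxIm_cpxI_mul (a : CpxRing B) : cpxIm B (cpxI B * a) = cpxRe B a := by
  induction a using TensorProduct.induction_on with
  | zero => simp
  | tmul b c =>
    rw [cpxI, Algebra.TensorProduct.tmul_mul_tmul, cpxRe_tmul, cpxIm_tmul]; simp
  | add s t hs ht => rw [mul_add, map_add, map_add, hs, ht]

lemma cpxRe_ringConj (a : CpxRing B) : cpxRe B (ringConj B a) = cpxRe B a := by
  induction a using TensorProduct.induction_on with
  | zero => simp
  | tmul b c => simp [ringConj, cpxRe_tmul]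
  | add s t hs ht => simp only [map_add, hs, ht]

lemma cpxIm_ringConj (a : CpxRing B) : cpxIm B (ringConj B a) = -cpxIm B a := by
  induction a using TensorProduct.induction_on with
  | zero => simp
  | tmul b c => simp [ringConj, cpxIm_tmul]
  | add s t hs ht => simp only [map_add, hs, ht, neg_add]

variable {B} {R : Type} [CommRing R]

lemma cpx_hom_ext {f g : CpxRing B →+* R}
    (h : ∀ b, f (algebraMap B (CpxRing B) b) = g (algebraMap B (CpxRing B) b))
    (hI : f (cpxI B) = g (cpxI B)) : f = g := by
  refine RingHom.ext fun a => ?_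
  rw [← cpxRe_add_cpxIm B a, map_add, map_add, map_mul, map_mul, h, h, hI]

/-- The homomorphism `B ⊗_ℝ ℂ → R` that extends `f` and sends the imaginary unit to `J`. -/
def cpxLift (f : B →+* R) (J : R) (hJ : J * J = -1) : CpxRing B →+* R :=
  letI : Algebra ℝ R := (f.comp (algebraMap ℝ B)).toAlgebra
  (Algebra.TensorProduct.lift (AlgHom.mk f (fun _ => rfl) : B →ₐ[ℝ] R)
    (Complex.lift ⟨J, hJ⟩) (fun _ _ => Commute.all _ _)).toRingHom

lemma cpxLift_algebraMap (f : B →+* R) (J : R) (hJ : J * J = -1) (b : B) :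
    cpxLift f J hJ (algebraMap B (CpxRing B) b) = f b := by
  let _ : Algebra ℝ R := (f.comp (algebraMap ℝ B)).toAlgebra
  change Algebra.TensorProduct.lift (AlgHom.mk f (fun _ => rfl) : B →ₐ[ℝ] R)
    (Complex.lift ⟨J, hJ⟩) (fun _ _ => Commute.all _ _) (b ⊗ₜ 1) = f b
  rw [Algebra.TensorProduct.lift_tmul, map_one, mul_one]
  rfl

lemma cpxLift_cpxI (f : B →+* R) (J : R) (hJ : J * J = -1) :
    cpxLift f J hJ (cpxI B) = J := by
  let _ : Algebra ℝ R := (f.comp (algebraMap ℝ B)).toAlgebra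
  change Algebra.TensorProduct.lift (AlgHom.mk f (fun _ => rfl) : B →ₐ[ℝ] R)
    (Complex.lift ⟨J, hJ⟩) (fun _ _ => Commute.all _ _) (1 ⊗ₜ Complex.I) = J
  rw [Algebra.TensorProduct.lift_tmul, map_one, one_mul]
  exact Complex.liftAux_apply_I _ hJ

end Complexification

/-! ## Coordinates on the complex sphere -/

/-- The coordinates `x`, `y`, `z` in the coordinate ring of `𝕊²_ℂ`. -/
def cpxCoord (i : Fin 3) : CpxRing SphereRing :=
  algebraMap SphereRing (CpxRing SphereRing) (sphereCoord i)

lemma sphereCoord_relation :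
    sphereCoord 0 ^ 2 + sphereCoord 1 ^ 2 + sphereCoord 2 ^ 2 = 1 := by
  rw [← sub_eq_zero]
  exact (Ideal.Quotient.eq_zero_iff_mem.mpr (Ideal.mem_span_singleton_self sphereEq))

/-- The function `x + i y`. -/
def coordPlus : CpxRing SphereRing := cpxCoord 0 + cpxI SphereRing * cpxCoord 1

/-- The function `x - i y`. -/
def coordMinus : CpxRing SphereRing := cpxCoord 0 - cpxI SphereRing * cpxCoord 1

/-- The equation of the sphere, read as the vanishing of the determinant of `(1+z, x+iy; x-iy,
1-z)`. -/
lemma coordPlus_mul_coordMinus :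
    coordPlus * coordMinus = (1 + cpxCoord 2) * (1 - cpxCoord 2) := by
  have h := congrArg (algebraMap SphereRing (CpxRing SphereRing)) sphereCoord_relation
  simp only [map_add, map_pow, map_one] at h
  change cpxCoord 0 ^ 2 + cpxCoord 1 ^ 2 + cpxCoord 2 ^ 2 = 1 at h
  unfold coordPlus coordMinus
  linear_combination h - cpxCoord 1 ^ 2 * cpxI_mul_cpxI SphereRing

lemma ringConj_cpxCoord (i : Fin 3) : ringConj SphereRing (cpxCoord i) = cpxCoord i :=
  ringConj_algebraMap _ _

lemma ringConj_coordPlus : ringConj SphereRing coordPlus = coordMinus := by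
  rw [coordPlus, coordMinus, map_add, map_mul, ringConj_cpxI, ringConj_cpxCoord, ringConj_cpxCoord]
  ring

lemma ringConj_coordMinus : ringConj SphereRing coordMinus = coordPlus := by
  rw [← ringConj_coordPlus, ringConj_ringConj]

/-- The element `1 / 2`. -/
def cpxHalf : CpxRing SphereRing := algebraMap SphereRing _ (algebraMap ℝ SphereRing 2⁻¹)

lemma two_mul_cpxHalf : 2 * cpxHalf = 1 := by
  rw [cpxHalf, ← map_ofNat (algebraMap SphereRing (CpxRing SphereRing)) 2, ← map_mul,
    ← map_ofNat (algebraMap ℝ SphereRing) 2, ← map_mul, mul_inv_cancel₀ two_ne_zero, map_one, map_one]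

lemma sphere_hom_ext {R : Type} [CommRing R] {f g : CpxRing SphereRing →+* R}
    (hC : ∀ c : ℂ, f (1 ⊗ₜ c) = g (1 ⊗ₜ c))
    (h : ∀ i, f (cpxCoord i) = g (cpxCoord i)) : f = g := by
  refine cpx_hom_ext (fun b => ?_) (hC Complex.I)
  obtain ⟨p, rfl⟩ := Ideal.Quotient.mk_surjective b
  induction p using MvPolynomial.induction_on with
  | C r =>
    have : algebraMap SphereRing (CpxRing SphereRing) (Ideal.Quotient.mk _ (MvPolynomial.C r)) =
        1 ⊗ₜ (r : ℂ) := by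
      change algebraMap ℝ SphereRing r ⊗ₜ[ℝ] (1 : ℂ) = 1 ⊗ₜ (r : ℂ)
      rw [Algebra.algebraMap_eq_smul_one, TensorProduct.smul_tmul]
      simp
    rw [this, hC]
  | add p q hp hq => simp only [map_add, hp, hq]
  | mul_X p i hp =>
    rw [map_mul, map_mul, map_mul, map_mul, hp]
    exact congrArg _ (h i)

/-! ## The image and the kernel of the comorphism `quadPull` -/

lemma quadPull_one_tmul (c : ℂ) : quadPull (1 ⊗ₜ c) = algebraMap BiRing BiLoc (MvPolynomial.C c) := by
  rw [quadPull, Algebra.TensorProduct.lift_tmul, map_one, one_mul]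
  exact IsScalarTower.algebraMap_apply ℂ BiRing BiLoc c

lemma quadPull_cpxI : quadPull (cpxI SphereRing) =
    algebraMap BiRing BiLoc (MvPolynomial.C Complex.I) := quadPull_one_tmul _

lemma quadPull_cpxCoord (i : Fin 3) :
    quadPull (cpxCoord i) = algebraMap BiRing BiLoc (quadXYZ i) * invT := by
  have : quadPull (cpxCoord i) = polyPull (MvPolynomial.X i) := by
    rw [cpxCoord, quadPull, Algebra.TensorProduct.algebraMap_apply,
      Algebra.TensorProduct.lift_tmul, map_one, mul_one]
    rfl
  rw [this, polyPull, MvPolynomial.aeval_X]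

lemma algebraMap_C_I_sq :
    algebraMap BiRing BiLoc (MvPolynomial.C Complex.I) ^ 2 = -1 := by
  rw [← map_pow, ← map_pow, Complex.I_sq, map_neg, map_neg, map_one, map_one]

/-- The element `x_i` of the localization. -/
def xl (i : Fin 2) : BiLoc := algebraMap BiRing BiLoc (xv i)

/-- The element `y_i` of the localization. -/
def yl (i : Fin 2) : BiLoc := algebraMap BiRing BiLoc (yv i)

lemma xl_yl_invT : (xl 0 * yl 0 + xl 1 * yl 1) * invT = 1 := by
  have h : algebraMap BiRing BiLoc quadT = xl 0 * yl 0 + xl 1 * yl 1 := by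
    simp only [quadT, map_add, map_mul, xl, yl]
  rw [← h, quadT_mul_invT]

lemma quadPull_coordPlus : quadPull coordPlus = 2 * (xl 0 * yl 1 * invT) := by
  rw [coordPlus, map_add, map_mul, quadPull_cpxCoord, quadPull_cpxCoord, quadPull_cpxI]
  simp only [quadXYZ, Matrix.cons_val_zero, Matrix.cons_val_one, map_add, map_mul, map_sub, xl, yl]
  linear_combination (algebraMap BiRing BiLoc (xv 1) * algebraMap BiRing BiLoc (yv 0) -
    algebraMap BiRing BiLoc (xv 0) * algebraMap BiRing BiLoc (yv 1)) * invT * algebraMap_C_I_sq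

lemma quadPull_coordMinus : quadPull coordMinus = 2 * (xl 1 * yl 0 * invT) := by
  rw [coordMinus, map_sub, map_mul, quadPull_cpxCoord, quadPull_cpxCoord, quadPull_cpxI]
  simp only [quadXYZ, Matrix.cons_val_zero, Matrix.cons_val_one, map_add, map_mul, map_sub, xl, yl]
  linear_combination -(algebraMap BiRing BiLoc (xv 1) * algebraMap BiRing BiLoc (yv 0) -
    algebraMap BiRing BiLoc (xv 0) * algebraMap BiRing BiLoc (yv 1)) * invT * algebraMap_C_I_sq

lemma quadPull_one_add : quadPull (1 + cpxCoord 2) = 2 * (xl 0 * yl 0 * invT) := by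
  rw [map_add, map_one, quadPull_cpxCoord]
  simp only [quadXYZ, Matrix.cons_val, map_mul, map_sub]
  change 1 + (xl 0 * yl 0 - xl 1 * yl 1) * invT = _
  linear_combination -xl_yl_invT

lemma quadPull_one_sub : quadPull (1 - cpxCoord 2) = 2 * (xl 1 * yl 1 * invT) := by
  rw [map_sub, map_one, quadPull_cpxCoord]
  simp only [quadXYZ, Matrix.cons_val, map_mul, map_sub]
  change 1 - (xl 0 * yl 0 - xl 1 * yl 1) * invT = _
  linear_combination -xl_yl_invT

/-- A homomorphism on the coordinate ring of the sphere, together with a factorization of the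
matrix `(1 + z, x + i y; x - i y, 1 - z)` as a column times a row, factors through `quadPull`. -/
lemma exists_comp_quadPull {S : Type} [CommRing S] (h : CpxRing SphereRing →+* S) (a b : Fin 2 → S)
    (h00 : h (1 + cpxCoord 2) = 2 * (a 0 * b 0)) (h11 : h (1 - cpxCoord 2) = 2 * (a 1 * b 1))
    (h01 : h coordPlus = 2 * (a 0 * b 1)) (h10 : h coordMinus = 2 * (a 1 * b 0)) :
    ∃ ρ : BiLoc →+* S, ρ.comp quadPull.toRingHom = h := by
  let incl : ℂ →+* CpxRing SphereRing := (Algebra.TensorProduct.includeRight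
    (R := ℝ) (A := SphereRing) (B := ℂ)).toRingHom
  let g : BiRing →+* S := MvPolynomial.eval₂Hom (h.comp incl) (Sum.elim a b)
  have hgx : ∀ i, g (xv i) = a i := fun i => by simp [g, xv]
  have hgy : ∀ i, g (yv i) = b i := fun i => by simp [g, yv]
  have hgC : ∀ c, g (MvPolynomial.C c) = h (1 ⊗ₜ c) := fun c => by simp [g, incl]
  have hI : h (cpxI SphereRing) * h (cpxI SphereRing) = -1 := by
    rw [← map_mul, cpxI_mul_cpxI, map_neg, map_one]
  have half : 2 * h cpxHalf = 1 := by
    rw [← map_ofNat h 2, ← map_mul, two_mul_cpxHalf, map_one]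
  rw [map_add, map_one] at h00
  rw [map_sub, map_one] at h11
  rw [coordPlus, map_add, map_mul] at h01
  rw [coordMinus, map_sub, map_mul] at h10
  -- The two diagonal entries sum to `2`, so the chosen factorization is automatically normalized by
  -- `T = 1`; hence `g` extends to the localization.
  have hT : g quadT = 1 := by
    rw [quadT, map_add, map_mul, map_mul, hgx, hgx, hgy, hgy]
    linear_combination (1 - a 0 * b 0 - a 1 * b 1) * half - h cpxHalf * (h00 + h11)
  let ρ : BiLoc →+* S := IsLocalization.Away.lift quadT (g := g) (by rw [hT]; exact isUnit_one)
  have hρ : ∀ f, ρ (algebraMap BiRing BiLoc f) = g f :=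
    fun f => IsLocalization.Away.lift_eq quadT _ f
  have hρT : ρ invT = 1 := by
    have := congrArg ρ quadT_mul_invT
    rwa [map_mul, hρ, hT, one_mul, map_one] at this
  refine ⟨ρ, sphere_hom_ext (fun c => ?_) (fun i => ?_)⟩
  · change ρ (quadPull _) = _
    rw [quadPull_one_tmul, hρ, hgC]
  · change ρ (quadPull _) = _
    rw [quadPull_cpxCoord, map_mul, hρ, hρT, mul_one]
    fin_cases i
    · simp only [quadXYZ, Fin.zero_eta, Matrix.cons_val_zero, map_add, map_mul, hgx, hgy]
      linear_combination (h (cpxCoord 0) - a 0 * b 1 - a 1 * b 0) * half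
        - h cpxHalf * (h01 + h10)
    · simp only [quadXYZ, Fin.mk_one, Matrix.cons_val_one, Matrix.cons_val_zero, map_sub, map_mul,
        hgx, hgy, hgC]
      change h (cpxI SphereRing) * _ = _
      linear_combination
        (h (cpxCoord 1) - h (cpxI SphereRing) * (a 1 * b 0 - a 0 * b 1)) * half
        + h cpxHalf * h (cpxI SphereRing) * (h01 - h10) - 2 * h (cpxCoord 1) * h cpxHalf * hI
    · simp only [quadXYZ, Fin.reduceFinMk, Matrix.cons_val, map_sub, map_mul, hgx, hgy]
      linear_combination (h (cpxCoord 2) - a 0 * b 0 + a 1 * b 1) * half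
        - h cpxHalf * (h00 - h11)

/-- Where `1 + z` or `1 - z` is invertible, the rank one matrix factors as a column times a row, and
`exists_comp_quadPull` makes the localization map factor through `quadPull`. An element of the
kernel is therefore killed by a power of `1 + z` and by a power of `1 - z`, and these are coprime
because their sum is `2`. -/
lemma quadPull_injective : Function.Injective quadPull := by
  rw [injective_iff_map_eq_zero]
  intro c hc
  have key : ∀ (u v : CpxRing SphereRing), coordPlus * coordMinus = u * v →
      (∃ ρ : BiLoc →+* Localization.Away u,
        ρ.comp quadPull.toRingHom = algebraMap _ (Localization.Away u)) → ∃ k, u ^ k * c = 0 := by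
    rintro u v - ⟨ρ, hρ⟩
    have h0 : algebraMap _ (Localization.Away u) c = 0 := by
      rw [← hρ]
      change ρ (quadPull c) = 0
      rw [hc, map_zero]
    obtain ⟨⟨m, k, rfl⟩, hm⟩ := (IsLocalization.map_eq_zero_iff (Submonoid.powers u) _ c).mp h0
    exact ⟨k, hm⟩
  have hrel := coordPlus_mul_coordMinus
  obtain ⟨k, hk⟩ : ∃ k, (1 + cpxCoord 2) ^ k * c = 0 := by
    refine key _ _ hrel ?_
    let φ := algebraMap (CpxRing SphereRing) (Localization.Away (1 + cpxCoord 2))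
    let s : Localization.Away (1 + cpxCoord 2) := IsLocalization.Away.invSelf (1 + cpxCoord 2)
    have hs : φ (1 + cpxCoord 2) * s = 1 := IsLocalization.Away.mul_invSelf _
    have half : 2 * φ cpxHalf = 1 := by
      rw [← map_ofNat φ 2, ← map_mul, two_mul_cpxHalf, map_one]
    have hrel' := congrArg φ hrel
    rw [map_mul, map_mul] at hrel'
    -- The column is normalized to have first entry `1`; the row is then half of the first row of
    -- the matrix.
    refine exists_comp_quadPull φ ![1, φ coordMinus * s]
      ![φ (1 + cpxCoord 2) * φ cpxHalf, φ coordPlus * φ cpxHalf] ?_ ?_ ?_ ?_ <;>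
      simp only [Matrix.cons_val_zero, Matrix.cons_val_one]
    · linear_combination -φ (1 + cpxCoord 2) * half
    · linear_combination -φ (1 - cpxCoord 2) * half
        - φ (1 - cpxCoord 2) * 2 * φ cpxHalf * hs - 2 * φ cpxHalf * s * hrel'
    · linear_combination -φ coordPlus * half
    · linear_combination -φ coordMinus * half - φ coordMinus * 2 * φ cpxHalf * hs
  obtain ⟨l, hl⟩ : ∃ l, (1 - cpxCoord 2) ^ l * c = 0 := by
    refine key _ _ (hrel.trans (mul_comm _ _)) ?_
    let φ := algebraMap (CpxRing SphereRing) (Localization.Away (1 - cpxCoord 2))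
    let s : Localization.Away (1 - cpxCoord 2) := IsLocalization.Away.invSelf (1 - cpxCoord 2)
    have hs : φ (1 - cpxCoord 2) * s = 1 := IsLocalization.Away.mul_invSelf _
    have half : 2 * φ cpxHalf = 1 := by
      rw [← map_ofNat φ 2, ← map_mul, two_mul_cpxHalf, map_one]
    have hrel' := congrArg φ hrel
    rw [map_mul, map_mul] at hrel'
    refine exists_comp_quadPull φ ![φ coordPlus * s, 1]
      ![φ coordMinus * φ cpxHalf, φ (1 - cpxCoord 2) * φ cpxHalf] ?_ ?_ ?_ ?_ <;>
      simp only [Matrix.cons_val_zero, Matrix.cons_val_one]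
    · linear_combination -φ (1 + cpxCoord 2) * half
        - φ (1 + cpxCoord 2) * 2 * φ cpxHalf * hs - 2 * φ cpxHalf * s * hrel'
    · linear_combination -φ (1 - cpxCoord 2) * half
    · linear_combination -φ coordPlus * half - φ coordPlus * 2 * φ cpxHalf * hs
    · linear_combination -φ coordMinus * half
  have hcop : IsCoprime (1 + cpxCoord 2) (1 - cpxCoord 2) :=
    ⟨cpxHalf, cpxHalf, by linear_combination two_mul_cpxHalf⟩
  obtain ⟨s, t, hst⟩ := hcop.pow (m := k) (n := l)
  linear_combination -c * hst + s * hk + t * hl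

/-- The doubles of these four elements are the images of `1 + z`, `x + iy`, `x - iy` and `1 - z`. -/
lemma xl_mul_yl_mem_range (i j : Fin 2) : xl i * yl j * invT ∈ quadPull.range := by
  have key : ∀ (c : CpxRing SphereRing) (t : BiLoc), quadPull c = 2 * t → t ∈ quadPull.range := by
    intro c t h
    refine ⟨cpxHalf * c, ?_⟩
    have half : 2 * quadPull cpxHalf = 1 := by
      rw [← map_ofNat quadPull 2, ← map_mul, two_mul_cpxHalf, map_one]
    change quadPull (cpxHalf * c) = t
    rw [map_mul, h]
    linear_combination t * half
  fin_cases i <;> fin_cases j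
  · exact key _ _ quadPull_one_add
  · exact key _ _ quadPull_coordPlus
  · exact key _ _ quadPull_coordMinus
  · exact key _ _ quadPull_one_sub

/-- Equal degrees in the `x` and the `y` variables allow each `x_i` to be paired with some `y_j` and
one factor `1 / T`. As many pairs `x_0 y_0` as possible are formed; the surplus `x_0` go with `y_1`,
or the surplus `y_0` with `x_1`. -/
lemma monomial_mem_range (a b c d k : ℕ) (h₁ : a + b = k) (h₂ : c + d = k) :
    xl 0 ^ a * xl 1 ^ b * (yl 0 ^ c * yl 1 ^ d) * invT ^ k ∈ quadPull.range := by
  subst h₁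
  rcases le_total c a with h | h
  · obtain ⟨e, rfl⟩ := Nat.exists_eq_add_of_le h
    obtain rfl : d = e + b := by omega
    have := mul_mem (mul_mem (pow_mem (xl_mul_yl_mem_range 0 0) c)
      (pow_mem (xl_mul_yl_mem_range 0 1) e)) (pow_mem (xl_mul_yl_mem_range 1 1) b)
    convert this using 1
    simp only [mul_pow, pow_add]
    ring
  · obtain ⟨e, rfl⟩ := Nat.exists_eq_add_of_le h
    obtain rfl : b = e + d := by omega
    have := mul_mem (mul_mem (pow_mem (xl_mul_yl_mem_range 0 0) a)
      (pow_mem (xl_mul_yl_mem_range 1 0) e)) (pow_mem (xl_mul_yl_mem_range 1 1) d)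
    convert this using 1
    simp only [mul_pow, pow_add]
    ring

lemma mem_range_quadPull {t : BiLoc} (ht : IsBihom 0 0 t) : ∃ c, quadPull c = t := by
  obtain ⟨k, f, hf, rfl⟩ := ht
  rw [zero_add] at hf
  suffices h : algebraMap BiRing BiLoc f * invT ^ k ∈ quadPull.range from h
  rw [f.as_sum, map_sum, Finset.sum_mul]
  refine sum_mem fun d hd => ?_
  have hw := hf (MvPolynomial.mem_support_iff.mp hd)
  rw [Finsupp.weight_apply, Finsupp.sum_fintype _ _ (by simp)] at hw
  simp only [Fintype.sum_sum_type, Fin.sum_univ_two, biWeight, Sum.elim_inl, Sum.elim_inr] at hw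
  have h₁ := congrArg Prod.fst hw
  have h₂ := congrArg Prod.snd hw
  simp at h₁ h₂
  rw [MvPolynomial.monomial_eq, map_mul, Finsupp.prod_fintype _ _ (by simp)]
  simp only [Fintype.prod_sum_type, Fin.prod_univ_two, map_mul, map_pow]
  rw [mul_assoc, ← quadPull_one_tmul]
  exact mul_mem ⟨_, rfl⟩ (monomial_mem_range _ _ _ _ k h₁ h₂)

/-! ## Coordinates on the line bundles -/

instance lineSectionsModule (n : ℕ) : Module (CpxRing SphereRing) (lineSections n) :=
  (lineSections n).module

instance lineSectionsSMul (n : ℕ) : SMul (CpxRing SphereRing) (lineSections n) :=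
  (lineSectionsModule n).toSMul

lemma IsBihom.mul_invT_pow {n : ℕ} {t : BiLoc} (ht : IsBihom n n t) :
    IsBihom 0 0 (t * invT ^ n) := by
  obtain ⟨k, f, hf, rfl⟩ := ht
  exact ⟨n + k, f, by simpa using hf, by rw [pow_add]; ring⟩

lemma IsBihom.one : IsBihom 0 0 1 := by
  simpa using IsBihom.const 1

lemma IsBihom.pow {a b : ℕ} {t : BiLoc} (ht : IsBihom a b t) (n : ℕ) :
    IsBihom (n * a) (n * b) (t ^ n) := by
  induction n with
  | zero => simpa using IsBihom.one
  | succ n ih => rw [pow_succ, add_mul, add_mul, one_mul, one_mul]; exact ih.mul ht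

lemma xl_bihom (i : Fin 2) : IsBihom 1 0 (xl i) :=
  ⟨0, xv i, xv_bihom i, by rw [pow_zero, mul_one]; rfl⟩

lemma yl_bihom (i : Fin 2) : IsBihom 0 1 (yl i) :=
  ⟨0, yv i, yv_bihom i, by rw [pow_zero, mul_one]; rfl⟩

/-- Multiplication by `y_j^n` moves bidegree `(n,0)` to `(n,n)`, and division by `T^n` brings it to
`(0,0)`. The factor `2^n` makes the pairings with `x_i^n` exact powers of the coordinate functions.
-/
lemma exists_lineCoord (n : ℕ) (j : Fin 2) (m : lineSections n) :
    ∃ c, quadPull c = (2 * yl j) ^ n * m * invT ^ n := by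
  refine mem_range_quadPull (IsBihom.mul_invT_pow ?_)
  have h2 : IsBihom 0 0 2 := by
    rw [← map_ofNat (algebraMap ℂ BiLoc) 2]; exact IsBihom.const 2
  simpa using ((h2.mul (yl_bihom j)).pow n).mul m.2

/-- The linear form `(2 y_j)^n / T^n` on the sections of `L_n`. -/
def lineCoord (n : ℕ) (j : Fin 2) : lineSections n →ₗ[CpxRing SphereRing] CpxRing SphereRing where
  toFun m := (exists_lineCoord n j m).choose
  -- The value is chosen as a preimage; injectivity of `quadPull` makes it unique, so linearity can
  -- be checked in the localization.
  map_add' a b := by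
    apply quadPull_injective
    rw [map_add, (exists_lineCoord n j a).choose_spec, (exists_lineCoord n j b).choose_spec,
      (exists_lineCoord n j _).choose_spec, Submodule.coe_add]
    ring
  map_smul' a b := by
    apply quadPull_injective
    rw [RingHom.id_apply, smul_eq_mul, map_mul, (exists_lineCoord n j b).choose_spec,
      (exists_lineCoord n j _).choose_spec, Submodule.coe_smul]
    change _ * (quadPull a * _) * _ = _
    ring

lemma quadPull_lineCoord (n : ℕ) (j : Fin 2) (m : lineSections n) :
    quadPull (lineCoord n j m) = (2 * yl j) ^ n * m * invT ^ n :=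
  (exists_lineCoord n j m).choose_spec

/-- The section `x_i^n` of `L_n`. -/
def linePow (n : ℕ) (i : Fin 2) : lineSections n :=
  ⟨xl i ^ n, by simpa using! (xl_bihom i).pow n⟩

lemma coe_linePow (n : ℕ) (i : Fin 2) : (linePow n i : BiLoc) = xl i ^ n := rfl

lemma lineCoord_zero_linePow_zero (n : ℕ) :
    lineCoord n 0 (linePow n 0) = (1 + cpxCoord 2) ^ n := by
  apply quadPull_injective
  rw [quadPull_lineCoord, coe_linePow, map_pow, quadPull_one_add]
  simp only [mul_pow]; ring

lemma lineCoord_one_linePow_zero (n : ℕ) : lineCoord n 1 (linePow n 0) = coordPlus ^ n := by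
  apply quadPull_injective
  rw [quadPull_lineCoord, coe_linePow, map_pow, quadPull_coordPlus]
  simp only [mul_pow]; ring

lemma lineCoord_zero_linePow_one (n : ℕ) : lineCoord n 0 (linePow n 1) = coordMinus ^ n := by
  apply quadPull_injective
  rw [quadPull_lineCoord, coe_linePow, map_pow, quadPull_coordMinus]
  simp only [mul_pow]; ring

lemma lineCoord_one_linePow_one (n : ℕ) :
    lineCoord n 1 (linePow n 1) = (1 - cpxCoord 2) ^ n := by
  apply quadPull_injective
  rw [quadPull_lineCoord, coe_linePow, map_pow, quadPull_one_sub]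
  simp only [mul_pow]; ring

/-- In the localization `g_j(m) x_j^n` is `m` times `(2 x_j y_j / T)^n`, so the right side is `m`
times the partition of unity. -/
lemma lineSections_expansion {n : ℕ} {p r : CpxRing SphereRing}
    (h : (1 + cpxCoord 2) ^ n * p + (1 - cpxCoord 2) ^ n * r = 1) (m : lineSections n) :
    m = (p * lineCoord n 0 m) • linePow n 0 + (r * lineCoord n 1 m) • linePow n 1 := by
  apply Subtype.ext
  rw [Submodule.coe_add, Submodule.coe_smul, Submodule.coe_smul]
  change (m : BiLoc) = quadPull (p * lineCoord n 0 m) * xl 0 ^ n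
    + quadPull (r * lineCoord n 1 m) * xl 1 ^ n
  have h' := congrArg quadPull h
  rw [map_add, map_mul, map_mul, map_pow, map_pow, quadPull_one_add, quadPull_one_sub, map_one]
    at h'
  rw [map_mul, map_mul, quadPull_lineCoord, quadPull_lineCoord]
  simp only [mul_pow] at h' ⊢
  linear_combination -(m : BiLoc) * h'

/-! ## Forms on the descended bundle -/

section Forms

variable {B M : Type} [CommRing B] [Algebra ℝ B] [AddCommGroup M] [Module (CpxRing B) M]

/-- The first component of an element of the descended module. -/
def sectionFst (v : descent B M) : M := Prod.fst v.1

/-- The element of the descended module with given first component. -/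
def sectionOf (m : M) : descent B M := ⟨(m, toTwist B M m), rfl⟩

/-- Invariance under the exchange forces the second component to equal the first, so the descended
module is `M` over `B`. -/
lemma sectionOf_sectionFst (v : descent B M) : sectionOf (sectionFst v) = v := by
  apply Subtype.ext
  have h : toTwist B M (Prod.fst v.1) = Prod.snd v.1 :=
    congrArg (fun w : M × ConjTwist B M => w.2) v.2
  exact Prod.ext rfl h

lemma sectionFst_sectionOf (m : M) : sectionFst (sectionOf m : descent B M) = m := rfl

lemma sectionFst_injective : Function.Injective (sectionFst (B := B) (M := M)) :=
  Function.LeftInverse.injective sectionOf_sectionFst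

lemma sectionFst_add (v w : descent B M) : sectionFst (v + w) = sectionFst v + sectionFst w := rfl

lemma sectionFst_smul (b : B) (v : descent B M) :
    sectionFst (b • v) = algebraMap B (CpxRing B) b • sectionFst v := rfl

lemma sectionOf_add (m m' : M) :
    (sectionOf (m + m') : descent B M) = sectionOf m + sectionOf m' := rfl

lemma sectionOf_smul (b : B) (m : M) :
    (sectionOf (algebraMap B (CpxRing B) b • m) : descent B M) = b • sectionOf m :=
  sectionFst_injective (by rw [sectionFst_smul, sectionFst_sectionOf, sectionFst_sectionOf])

variable (B M) in
/-- The module of complex valued forms on the descended module. -/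
abbrev CpxForms : Type := descent B M →ₗ[B] CpxRing B

/-- The form on the descended module defined by a form on `M`. -/
def restrictForm (g : M →ₗ[CpxRing B] CpxRing B) : CpxForms B M where
  toFun v := g (sectionFst v)
  map_add' v w := by rw [sectionFst_add, map_add]
  map_smul' b v := by
    rw [sectionFst_smul, map_smul, RingHom.id_apply, algebraMap_smul]

/-- The complex conjugate of a form. -/
def conjForm (φ : CpxForms B M) : CpxForms B M := (ringConj B).toLinearMap ∘ₗ φ

/-- Twice the `ℂ`-linear part of a form at `m`. -/
def linearPart (m : M) : CpxForms B M →ₗ[CpxRing B] CpxRing B where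
  toFun φ := φ (sectionOf m) - cpxI B * φ (sectionOf (cpxI B • m))
  map_add' φ ψ := by rw [LinearMap.add_apply, LinearMap.add_apply]; ring
  map_smul' a φ := by
    simp only [LinearMap.smul_apply, smul_eq_mul, RingHom.id_apply]; ring

/-- Twice the `ℂ`-antilinear part of a form at `m`. -/
def antilinearPart (m : M) : CpxForms B M →ₗ[CpxRing B] CpxRing B where
  toFun φ := φ (sectionOf m) + cpxI B * φ (sectionOf (cpxI B • m))
  map_add' φ ψ := by rw [LinearMap.add_apply, LinearMap.add_apply]; ring
  map_smul' a φ := by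
    simp only [LinearMap.smul_apply, smul_eq_mul, RingHom.id_apply]; ring

lemma linearPart_apply (m : M) (φ : CpxForms B M) :
    linearPart m φ = φ (sectionOf m) - cpxI B * φ (sectionOf (cpxI B • m)) := rfl

lemma antilinearPart_apply (m : M) (φ : CpxForms B M) :
    antilinearPart m φ = φ (sectionOf m) + cpxI B * φ (sectionOf (cpxI B • m)) := rfl

/-- The splitting of a real linear form into its linear and antilinear parts. The factor `2` avoids
dividing in a general `B`. -/
lemma two_mul_form_smul (φ : CpxForms B M) (m : M) (c : CpxRing B) :
    2 * φ (sectionOf (c • m)) = linearPart m φ * c + antilinearPart m φ * ringConj B c := by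
  obtain ⟨a, b, rfl⟩ : ∃ a b, algebraMap B (CpxRing B) a + cpxI B * algebraMap B (CpxRing B) b = c :=
    ⟨_, _, cpxRe_add_cpxIm B c⟩
  have h1 : (algebraMap B (CpxRing B) a + cpxI B * algebraMap B (CpxRing B) b) • m =
      algebraMap B (CpxRing B) a • m + algebraMap B (CpxRing B) b • (cpxI B • m) := by
    rw [smul_smul, ← add_smul, mul_comm (cpxI B)]
  have hs : ∀ (b : B) (v : descent B M), φ (b • v) = algebraMap B (CpxRing B) b * φ v :=
    fun b v => (map_smul φ b v).trans (Algebra.smul_def b (φ v))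
  rw [h1, sectionOf_add, map_add, sectionOf_smul, sectionOf_smul, hs, hs, linearPart_apply,
    antilinearPart_apply, map_add, map_mul, ringConj_algebraMap, ringConj_algebraMap, ringConj_cpxI]
  linear_combination
    2 * φ (sectionOf (cpxI B • m)) * algebraMap B (CpxRing B) b * cpxI_mul_cpxI B

variable (B M) in
/-- Two sections `s_i` and two forms `g_i` of a line bundle that generate the bundle and its dual,
whose pairings are hermitian, with a partition of unity `c`. -/
structure HermitianPair where
  s : Fin 2 → M
  g : Fin 2 → (M →ₗ[CpxRing B] CpxRing B)
  c : Fin 2 → CpxRing B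
  conj_c : ∀ i, ringConj B (c i) = c i
  conj_g : ∀ i j, ringConj B (g i (s j)) = g j (s i)
  -- This is where rank one enters: any two of the forms are proportional.
  comm : ∀ i j k m, g i (s j) * g k m = g k (s j) * g i m
  unity : c 0 * g 0 (s 0) + c 1 * g 1 (s 1) = 1
  expansion : ∀ m, m = (c 0 * g 0 m) • s 0 + (c 1 * g 1 m) • s 1

namespace HermitianPair

variable (d : HermitianPair B M)

/-- A frame of the module of complex valued forms on the descended module. -/
def frame : Fin 2 → CpxForms B M :=
  -- Relative to the linear and antilinear summands, the determinant is minus the sum in `unity`,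
  -- with `conj g_i` paired against `g_i` through the hermitian pairing.
  ![restrictForm (d.g 0) + conjForm (restrictForm (d.g 1)),
    d.c 1 • restrictForm (d.g 1) - d.c 0 • conjForm (restrictForm (d.g 0))]

lemma frame_zero_apply (v : descent B M) :
    d.frame 0 v = d.g 0 (sectionFst v) + ringConj B (d.g 1 (sectionFst v)) := rfl

lemma frame_one_apply (v : descent B M) :
    d.frame 1 v = d.c 1 * d.g 1 (sectionFst v) - d.c 0 * ringConj B (d.g 0 (sectionFst v)) := rfl

/-- Twice the coefficients of a form with respect to the frame. -/
def coef : Fin 2 → (CpxForms B M →ₗ[CpxRing B] CpxRing B) :=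
  ![(d.c 0 * (d.g 0 (d.s 0) * d.c 0)) • linearPart (d.s 0)
      + (d.c 0 * (d.c 1 * d.g 1 (d.s 0))) • antilinearPart (d.s 0)
      + (d.c 1 * (d.g 1 (d.s 0) * d.c 0)) • linearPart (d.s 1)
      + (d.c 1 * (d.g 1 (d.s 1) * d.c 1)) • antilinearPart (d.s 1),
    (d.c 0 * d.g 0 (d.s 1)) • linearPart (d.s 0)
      - (d.c 0 * d.g 0 (d.s 0)) • antilinearPart (d.s 0)
      + (d.c 1 * d.g 1 (d.s 1)) • linearPart (d.s 1)
      - (d.c 1 * d.g 0 (d.s 1)) • antilinearPart (d.s 1)]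

lemma coef_zero_apply (φ : CpxForms B M) :
    d.coef 0 φ = d.c 0 * (d.g 0 (d.s 0) * d.c 0) * linearPart (d.s 0) φ
      + d.c 0 * (d.c 1 * d.g 1 (d.s 0)) * antilinearPart (d.s 0) φ
      + d.c 1 * (d.g 1 (d.s 0) * d.c 0) * linearPart (d.s 1) φ
      + d.c 1 * (d.g 1 (d.s 1) * d.c 1) * antilinearPart (d.s 1) φ := rfl

lemma coef_one_apply (φ : CpxForms B M) :
    d.coef 1 φ = d.c 0 * d.g 0 (d.s 1) * linearPart (d.s 0) φ
      - d.c 0 * d.g 0 (d.s 0) * antilinearPart (d.s 0) φ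
      + d.c 1 * d.g 1 (d.s 1) * linearPart (d.s 1) φ
      - d.c 1 * d.g 0 (d.s 1) * antilinearPart (d.s 1) φ := rfl

/-- The conjugate of `comm`, rewritten by hermitian symmetry. -/
lemma conj_comm (i j k : Fin 2) (m : M) :
    d.g j (d.s i) * ringConj B (d.g k m) = d.g j (d.s k) * ringConj B (d.g i m) := by
  have h := congrArg (ringConj B) (d.comm i j k m)
  rwa [map_mul, map_mul, d.conj_g, d.conj_g] at h

/-- The frame generates. Expanding `v` along the sections writes `2 φ` as a combination of `g_0`,
`g_1` and their conjugates, with coefficients given by the linear and antilinear parts of `φ` at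
`s_0` and `s_1`. It remains to write these four forms in the frame, which is also the origin of the
formulas in `coef`. -/
lemma two_mul_form (φ : CpxForms B M) (v : descent B M) :
    2 * φ v = d.coef 0 φ * d.frame 0 v + d.coef 1 φ * d.frame 1 v := by
  rw [d.frame_zero_apply, d.frame_one_apply, d.coef_zero_apply, d.coef_one_apply]
  conv_lhs => rw [← sectionOf_sectionFst v, d.expansion (sectionFst v), sectionOf_add,
    map_add, mul_add, two_mul_form_smul, two_mul_form_smul, map_mul, map_mul, d.conj_c, d.conj_c]
  have e1 := d.comm 1 0 0 (sectionFst v)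
  have e2 := d.comm 0 1 1 (sectionFst v)
  have e3 := d.conj_comm 1 0 0 (sectionFst v)
  have e4 := d.conj_comm 0 1 1 (sectionFst v)
  have h := d.unity
  generalize ringConj B (d.g 0 (sectionFst v)) = a' at *
  generalize ringConj B (d.g 1 (sectionFst v)) = b' at *
  generalize d.g 0 (sectionFst v) = a at *
  generalize d.g 1 (sectionFst v) = b at *
  generalize d.g 0 (d.s 0) = u at *
  generalize d.g 1 (d.s 1) = s at *
  generalize d.g 1 (d.s 0) = w at *
  generalize d.g 0 (d.s 1) = w' at *
  generalize d.c 0 = p at *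
  generalize d.c 1 = r at *
  -- The four identities invert the frame: multiply the form by `unity`, then exchange factors by
  -- the rank one relations.
  have f0 : a = u * p * (a + b') + w' * (r * b - p * a') := by
    linear_combination -a * h - r * e2 + p * e3
  have f1 : a' = r * w * (a + b') - u * (r * b - p * a') := by
    linear_combination -a' * h - r * e1 - r * e4
  have f2 : b = w * p * (a + b') + s * (r * b - p * a') := by
    linear_combination -b * h - p * e1 - p * e4
  have f3 : b' = s * r * (a + b') - w' * (r * b - p * a') := by
    linear_combination -b' * h + r * e2 - p * e3
  linear_combination linearPart (d.s 0) φ * p * f0 + antilinearPart (d.s 0) φ * p * f1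
    + linearPart (d.s 1) φ * r * f2 + antilinearPart (d.s 1) φ * r * f3

/-- The conjugate is `g_1 + conj g_0`. Its coefficients are the sums of those of `g_1` and `conj
g_0` found in `two_mul_form`; `conj_frame_one` arises in the same way from `c_1 conj g_1 - c_0 g_0`.
-/
lemma conj_frame_zero (v : descent B M) : ringConj B (d.frame 0 v) =
    d.g 1 (d.s 0) * (d.c 0 + d.c 1) * d.frame 0 v
      + (d.g 1 (d.s 1) - d.g 0 (d.s 0)) * d.frame 1 v := by
  rw [d.frame_zero_apply, d.frame_one_apply, map_add, ringConj_ringConj]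
  have e1 := d.comm 1 0 0 (sectionFst v)
  have e4 := d.conj_comm 0 1 1 (sectionFst v)
  have h := d.unity
  linear_combination -(ringConj B (d.g 0 (sectionFst v)) + d.g 1 (sectionFst v)) * h
    - (d.c 0 + d.c 1) * e1 - (d.c 0 + d.c 1) * e4

lemma conj_frame_one (v : descent B M) : ringConj B (d.frame 1 v) =
    (-(d.g 0 (d.s 0) * d.c 0 ^ 2) + d.g 1 (d.s 1) * d.c 1 ^ 2) * d.frame 0 v
      + -(d.g 0 (d.s 1) * (d.c 0 + d.c 1)) * d.frame 1 v := by
  rw [d.frame_zero_apply, d.frame_one_apply, map_sub, map_mul, map_mul, d.conj_c, d.conj_c,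
    ringConj_ringConj]
  have e2 := d.comm 0 1 1 (sectionFst v)
  have e3 := d.conj_comm 1 0 0 (sectionFst v)
  have h := d.unity
  linear_combination (d.c 0 * d.g 0 (sectionFst v)
      - d.c 1 * ringConj B (d.g 1 (sectionFst v))) * h
    + d.c 1 * (d.c 0 + d.c 1) * e2 - d.c 0 * (d.c 0 + d.c 1) * e3

lemma linearPart_frame_zero (i : Fin 2) :
    linearPart (d.s i) (d.frame 0) = 2 * d.g 0 (d.s i) := by
  rw [linearPart_apply, d.frame_zero_apply, d.frame_zero_apply, sectionFst_sectionOf,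
    sectionFst_sectionOf, map_smul, map_smul, smul_eq_mul, smul_eq_mul, map_mul, ringConj_cpxI]
  linear_combination (ringConj B (d.g 1 (d.s i)) - d.g 0 (d.s i)) * cpxI_mul_cpxI B

lemma antilinearPart_frame_zero (i : Fin 2) :
    antilinearPart (d.s i) (d.frame 0) = 2 * d.g i (d.s 1) := by
  rw [antilinearPart_apply, d.frame_zero_apply, d.frame_zero_apply, sectionFst_sectionOf,
    sectionFst_sectionOf, map_smul, map_smul, smul_eq_mul, smul_eq_mul, map_mul, ringConj_cpxI,
    d.conj_g]
  linear_combination -(d.g i (d.s 1) - d.g 0 (d.s i)) * cpxI_mul_cpxI B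

lemma linearPart_frame_one (i : Fin 2) :
    linearPart (d.s i) (d.frame 1) = 2 * (d.c 1 * d.g 1 (d.s i)) := by
  rw [linearPart_apply, d.frame_one_apply, d.frame_one_apply, sectionFst_sectionOf,
    sectionFst_sectionOf, map_smul, map_smul, smul_eq_mul, smul_eq_mul, map_mul, ringConj_cpxI]
  linear_combination
    -(d.c 0 * ringConj B (d.g 0 (d.s i)) + d.c 1 * d.g 1 (d.s i)) * cpxI_mul_cpxI B

lemma antilinearPart_frame_one (i : Fin 2) :
    antilinearPart (d.s i) (d.frame 1) = -(2 * (d.c 0 * d.g i (d.s 0))) := by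
  rw [antilinearPart_apply, d.frame_one_apply, d.frame_one_apply, sectionFst_sectionOf,
    sectionFst_sectionOf, map_smul, map_smul, smul_eq_mul, smul_eq_mul, map_mul, ringConj_cpxI,
    d.conj_g]
  linear_combination (d.c 0 * d.g i (d.s 0) + d.c 1 * d.g 1 (d.s i)) * cpxI_mul_cpxI B

/-- The frame is independent. Since the pairing matrix has determinant zero (`e`), the diagonal
values are twice the square of the sum in `unity`; the others cancel formally. -/
lemma coef_frame (i j : Fin 2) : d.coef i (d.frame j) = if i = j then 2 else 0 := by
  have e := d.comm 1 0 0 (d.s 1)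
  have h := d.unity
  fin_cases i <;> fin_cases j <;>
    simp only [Fin.zero_eta, Fin.mk_one, d.coef_zero_apply, d.coef_one_apply,
      d.linearPart_frame_zero, d.linearPart_frame_one, d.antilinearPart_frame_zero,
      d.antilinearPart_frame_one]
  · simp only [if_true]
    linear_combination 4 * d.c 0 * d.c 1 * e
      + 2 * (d.c 0 * d.g 0 (d.s 0) + d.c 1 * d.g 1 (d.s 1) + 1) * h
  · simp only [zero_ne_one, if_false]
    ring
  · simp only [one_ne_zero, if_false]
    ring
  · simp only [if_true]
    linear_combination 4 * d.c 0 * d.c 1 * e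
      + 2 * (d.c 0 * d.g 0 (d.s 0) + d.c 1 * d.g 1 (d.s 1) + 1) * h

end HermitianPair

end Forms

/-! ## Regular functions and morphisms to affine schemes -/

lemma comp_appTop_apply {X Y Z : Scheme.{0}} (f : X ⟶ Y) (g : Y ⟶ Z) (a : Γ(Z, ⊤)) :
    (f ≫ g).appTop.hom a = f.appTop.hom (g.appTop.hom a) := by
  rw [Scheme.Hom.comp_appTop]; rfl

lemma SpecMap_appTop_apply {R S : CommRingCat.{0}} (φ : R ⟶ S) (a : R) :
    (Spec.map φ).appTop.hom ((Scheme.ΓSpecIso R).inv.hom a) =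
      (Scheme.ΓSpecIso S).inv.hom (φ.hom a) := by
  have h := congrArg (fun f => f.hom a) (Scheme.ΓSpecIso_inv_naturality φ)
  exact h.symm

lemma hom_Spec_ext {X : Scheme.{0}} {R : CommRingCat.{0}} {f g : X ⟶ Spec R}
    (h : ∀ a, f.appTop.hom ((Scheme.ΓSpecIso R).inv.hom a) =
      g.appTop.hom ((Scheme.ΓSpecIso R).inv.hom a)) : f = g := by
  apply ext_of_isAffine
  rw [← cancel_epi (Scheme.ΓSpecIso R).inv]
  ext a
  exact h a

/-- The morphism to an affine scheme given by a ring homomorphism. -/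
def homToSpec {X : Scheme.{0}} {R : CommRingCat.{0}} (g : R →+* Γ(X, ⊤)) : X ⟶ Spec R :=
  X.toSpecΓ ≫ Spec.map (CommRingCat.ofHom g)

lemma homToSpec_appTop_apply {X : Scheme.{0}} {R : CommRingCat.{0}} (g : R →+* Γ(X, ⊤)) (a : R) :
    (homToSpec g).appTop.hom ((Scheme.ΓSpecIso R).inv.hom a) = g a := by
  rw [homToSpec, comp_appTop_apply, SpecMap_appTop_apply, Scheme.toSpecΓ_appTop]
  exact congrArg (fun f => f.hom (g a)) (Scheme.ΓSpecIso Γ(X, ⊤)).inv_hom_id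

lemma homOfVector_coord {X S : Scheme.{0}} (f : X ⟶ S) (v : Fin 2 → Γ(X, ⊤)) (i : Fin 2) :
    (AffineSpace.homOfVector f v).appTop.hom (AffineSpace.coord S i) = v i :=
  AffineSpace.homOfVector_appTop_coord f v i

/-! ### Ring homomorphisms out of symmetric algebras -/

section SymmetricAlgebra

variable {B N R : Type} [CommRing B] [AddCommMonoid N] [Module B N] [CommRing R]

/-- The homomorphism on a symmetric algebra that extends `f` on the base ring and the semilinear
map `ψ` on the module. -/
def symLift (f : B →+* R) (ψ : N → R) (hadd : ∀ a b, ψ (a + b) = ψ a + ψ b)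
    (hsmul : ∀ b a, ψ (b • a) = f b * ψ a) : SymmetricAlgebra B N →+* R :=
  letI : Algebra B R := f.toAlgebra
  (SymmetricAlgebra.lift
    ({ toFun := ψ, map_add' := hadd, map_smul' := hsmul } : N →ₗ[B] R)).toRingHom

lemma symLift_algebraMap (f : B →+* R) (ψ : N → R) (hadd : ∀ a b, ψ (a + b) = ψ a + ψ b)
    (hsmul : ∀ b a, ψ (b • a) = f b * ψ a) (b : B) :
    symLift f ψ hadd hsmul (algebraMap B _ b) = f b :=
  let _ : Algebra B R := f.toAlgebra
  (SymmetricAlgebra.lift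
    ({ toFun := ψ, map_add' := hadd, map_smul' := hsmul } : N →ₗ[B] R)).commutes b

lemma symLift_ι (f : B →+* R) (ψ : N → R) (hadd : ∀ a b, ψ (a + b) = ψ a + ψ b)
    (hsmul : ∀ b a, ψ (b • a) = f b * ψ a) (a : N) :
    symLift f ψ hadd hsmul (SymmetricAlgebra.ι B N a) = ψ a :=
  let _ : Algebra B R := f.toAlgebra
  SymmetricAlgebra.lift_ι_apply
    ({ toFun := ψ, map_add' := hadd, map_smul' := hsmul } : N →ₗ[B] R) a

lemma symmetricAlgebra_hom_ext {f g : SymmetricAlgebra B N →+* R}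
    (h : ∀ b, f (algebraMap B _ b) = g (algebraMap B _ b))
    (h' : ∀ a, f (SymmetricAlgebra.ι B N a) = g (SymmetricAlgebra.ι B N a)) : f = g := by
  refine RingHom.ext fun a => ?_
  induction a using SymmetricAlgebra.induction with
  | algebraMap r => exact h r
  | ι x => exact h' x
  | mul a b ha hb => rw [map_mul, map_mul, ha, hb]
  | add a b ha hb => rw [map_add, map_add, ha, hb]

end SymmetricAlgebra

/-! ## Regular functions on complexifications -/

section Cpx

variable {X Y : Scheme.{0}} (f : X ⟶ Spec (.of ℝ))

/-- The constant function `i` on a complexification. -/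
def cpxUnit : Γ(Cpx f, ⊤) :=
  (cpxSnd f).appTop.hom ((Scheme.ΓSpecIso (.of ℂ)).inv.hom Complex.I)

lemma cpxUnit_mul_cpxUnit : cpxUnit f * cpxUnit f = -1 := by
  rw [cpxUnit, ← map_mul, ← map_mul]
  erw [Complex.I_mul_I]
  rw [map_neg, map_neg]
  erw [map_one, map_one]

lemma canonicalReal_fst : canonicalReal f ≫ cpxFst f = cpxFst f := pullback.lift_fst _ _ _

lemma canonicalReal_snd : canonicalReal f ≫ cpxSnd f = cpxSnd f ≫ specConj :=
  pullback.lift_snd _ _ _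

lemma specConj_comp_specConj : specConj ≫ specConj = 𝟙 _ := by
  rw [specConj, ← Spec.map_comp, ← CommRingCat.ofHom_comp, ← Spec.map_id]
  congr 2
  ext x
  exact Complex.conj_conj x

lemma canonicalReal_comp_self : canonicalReal f ≫ canonicalReal f = 𝟙 _ := by
  apply pullback.hom_ext
  · rw [Category.assoc, canonicalReal_fst, canonicalReal_fst, Category.id_comp]
  · rw [Category.assoc, canonicalReal_snd, ← Category.assoc, canonicalReal_snd, Category.assoc,
      specConj_comp_specConj, Category.comp_id, Category.id_comp]

lemma canonicalReal_appTop_fst (a : Γ(X, ⊤)) :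
    (canonicalReal f).appTop.hom ((cpxFst f).appTop.hom a) = (cpxFst f).appTop.hom a := by
  rw [← comp_appTop_apply, canonicalReal_fst]

lemma canonicalReal_appTop_cpxUnit :
    (canonicalReal f).appTop.hom (cpxUnit f) = -cpxUnit f := by
  rw [cpxUnit, ← comp_appTop_apply, canonicalReal_snd, comp_appTop_apply, specConj,
    SpecMap_appTop_apply]
  erw [Complex.conj_I]
  rw [map_neg, map_neg]

lemma cpxMap_fst (g : Y ⟶ X) : cpxMap g f ≫ cpxFst f = cpxFst (g ≫ f) ≫ g :=
  pullback.lift_fst _ _ _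

lemma cpxMap_snd (g : Y ⟶ X) : cpxMap g f ≫ cpxSnd f = cpxSnd (g ≫ f) :=
  pullback.lift_snd _ _ _

lemma cpxMap_appTop_fst (g : Y ⟶ X) (a : Γ(X, ⊤)) :
    (cpxMap g f).appTop.hom ((cpxFst f).appTop.hom a) =
      (cpxFst (g ≫ f)).appTop.hom (g.appTop.hom a) := by
  rw [← comp_appTop_apply, cpxMap_fst, comp_appTop_apply]

lemma cpxMap_appTop_cpxUnit (g : Y ⟶ X) :
    (cpxMap g f).appTop.hom (cpxUnit f) = cpxUnit (g ≫ f) := by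
  rw [cpxUnit, ← comp_appTop_apply, cpxMap_snd]; rfl

lemma canonicalReal_cpxMap (g : Y ⟶ X) :
    canonicalReal (g ≫ f) ≫ cpxMap g f = cpxMap g f ≫ canonicalReal f := by
  apply pullback.hom_ext
  · rw [Category.assoc, Category.assoc, canonicalReal_fst, cpxMap_fst, ← Category.assoc,
      canonicalReal_fst]
  · rw [Category.assoc, Category.assoc, canonicalReal_snd, cpxMap_snd, ← Category.assoc,
      cpxMap_snd, canonicalReal_snd]

end Cpx

/-- The homomorphism from the coordinate ring of `𝕊²_ℂ` to the ring of regular functions. -/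
def sphereCFun : CpxRing SphereRing →+* Γ(SphereC, ⊤) :=
  cpxLift sphereFun imagUnit (cpxUnit_mul_cpxUnit sphereHom)

lemma sphereCFun_algebraMap (b : SphereRing) :
    sphereCFun (algebraMap SphereRing (CpxRing SphereRing) b) = sphereFun b :=
  cpxLift_algebraMap _ _ _ b

lemma sphereCFun_cpxI : sphereCFun (cpxI SphereRing) = imagUnit := cpxLift_cpxI _ _ _

lemma canonicalReal_appTop_sphereCFun (a : CpxRing SphereRing) :
    (canonicalReal sphereHom).appTop.hom (sphereCFun a) = sphereCFun (ringConj SphereRing a) := by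
  have h : (canonicalReal sphereHom).appTop.hom.comp sphereCFun =
      sphereCFun.comp (ringConj SphereRing).toRingHom := by
    refine cpx_hom_ext (fun b => ?_) ?_
    · change (canonicalReal sphereHom).appTop.hom (sphereCFun (algebraMap _ _ b)) =
        sphereCFun (ringConj SphereRing (algebraMap _ _ b))
      rw [ringConj_algebraMap, sphereCFun_algebraMap]
      exact canonicalReal_appTop_fst sphereHom _
    · change (canonicalReal sphereHom).appTop.hom (sphereCFun (cpxI SphereRing)) =
        sphereCFun (ringConj SphereRing (cpxI SphereRing))
      rw [ringConj_cpxI, map_neg, sphereCFun_cpxI]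
      exact canonicalReal_appTop_cpxUnit sphereHom
  exact congrArg (fun g => g a) h

/-! ## Fibrewise linear functions on the complexified bundle -/

section Bundle

variable {N : Type} [AddCommMonoid N] [Module SphereRing N]

variable (N) in
/-- The projection of the complexified geometric vector bundle of `N`. -/
abbrev projC : Cpx (bundleProj SphereRing N ≫ sphereHom) ⟶ SphereC :=
  cpxMap (bundleProj SphereRing N) sphereHom

/-- The function on the complexified bundle given by a real form. -/
def realFun (l : Module.Dual SphereRing N) : Γ(Cpx (bundleProj SphereRing N ≫ sphereHom), ⊤) :=
  (cpxFst (bundleProj SphereRing N ≫ sphereHom)).appTop.hom (bundleForm SphereRing N l)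

lemma realFun_add (l l' : Module.Dual SphereRing N) :
    realFun (l + l') = realFun l + realFun l' := by
  rw [realFun, bundleForm, map_add, map_add, map_add]; rfl

lemma realFun_neg (l : Module.Dual SphereRing N) : realFun (-l) = -realFun l := by
  rw [realFun, bundleForm, map_neg, map_neg, map_neg]; rfl

lemma projC_appTop_sphereFun (b : SphereRing) :
    (projC N).appTop.hom (sphereFun b) =
      (cpxFst (bundleProj SphereRing N ≫ sphereHom)).appTop.hom
        ((Scheme.ΓSpecIso (.of (SymmetricAlgebra SphereRing (Module.Dual SphereRing N)))).inv.hom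
          (algebraMap SphereRing _ b)) := by
  refine (cpxMap_appTop_fst sphereHom (bundleProj SphereRing N) _).trans ?_
  rw [bundleProj, SpecMap_appTop_apply]
  rfl

lemma realFun_smul (b : SphereRing) (l : Module.Dual SphereRing N) :
    realFun (b • l) = (projC N).appTop.hom (sphereFun b) * realFun l := by
  rw [projC_appTop_sphereFun, realFun, realFun, bundleForm, map_smul, Algebra.smul_def, map_mul,
    map_mul]
  rfl

/-- The function on the complexified bundle given by a complex valued form. -/
def formFun (φ : N →ₗ[SphereRing] CpxRing SphereRing) :
    Γ(Cpx (bundleProj SphereRing N ≫ sphereHom), ⊤) :=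
  realFun (cpxRe SphereRing ∘ₗ φ) +
    (projC N).appTop.hom imagUnit * realFun (cpxIm SphereRing ∘ₗ φ)

lemma formFun_add (φ ψ : N →ₗ[SphereRing] CpxRing SphereRing) :
    formFun (φ + ψ) = formFun φ + formFun ψ := by
  rw [formFun, LinearMap.comp_add, LinearMap.comp_add, realFun_add, realFun_add, formFun, formFun]
  ring

lemma projC_imagUnit_mul :
    (projC N).appTop.hom imagUnit * (projC N).appTop.hom imagUnit = -1 := by
  rw [← map_mul]
  exact (congrArg _ (cpxUnit_mul_cpxUnit sphereHom)).trans (by rw [map_neg, map_one])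

/-- `formFun` is built from real and imaginary parts, so linearity over `B ⊗_ℝ ℂ` is verified for
scalars in `B` and for `i`, which together generate. -/
lemma formFun_smul (a : CpxRing SphereRing) (φ : N →ₗ[SphereRing] CpxRing SphereRing) :
    formFun (a • φ) = (projC N).appTop.hom (sphereCFun a) * formFun φ := by
  have hB : ∀ (b : SphereRing) (φ : N →ₗ[SphereRing] CpxRing SphereRing),
      formFun (algebraMap SphereRing (CpxRing SphereRing) b • φ) =
        (projC N).appTop.hom (sphereFun b) * formFun φ := by
    intro b φ
    have h : algebraMap SphereRing (CpxRing SphereRing) b • φ = b • φ :=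
      LinearMap.ext fun v => (Algebra.smul_def b (φ v)).symm
    rw [h, formFun, LinearMap.comp_smul, LinearMap.comp_smul, realFun_smul, realFun_smul, formFun]
    ring
  have hI : ∀ φ : N →ₗ[SphereRing] CpxRing SphereRing,
      formFun (cpxI SphereRing • φ) = (projC N).appTop.hom imagUnit * formFun φ := by
    intro φ
    have h1 : cpxRe SphereRing ∘ₗ (cpxI SphereRing • φ) = -(cpxIm SphereRing ∘ₗ φ) :=
      LinearMap.ext fun v => cpxRe_cpxI_mul SphereRing (φ v)
    have h2 : cpxIm SphereRing ∘ₗ (cpxI SphereRing • φ) = cpxRe SphereRing ∘ₗ φ :=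
      LinearMap.ext fun v => cpxIm_cpxI_mul SphereRing (φ v)
    rw [formFun, h1, h2, realFun_neg, formFun]
    linear_combination -realFun (cpxIm SphereRing ∘ₗ φ) * projC_imagUnit_mul (N := N)
  have h : a • φ = algebraMap SphereRing (CpxRing SphereRing) (cpxRe SphereRing a) • φ +
      cpxI SphereRing • algebraMap SphereRing (CpxRing SphereRing) (cpxIm SphereRing a) • φ := by
    refine LinearMap.ext fun v => ?_
    change a * φ v = algebraMap SphereRing (CpxRing SphereRing) (cpxRe SphereRing a) * φ v +
      cpxI SphereRing * (algebraMap SphereRing (CpxRing SphereRing) (cpxIm SphereRing a) * φ v)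
    linear_combination -φ v * cpxRe_add_cpxIm SphereRing a
  rw [h, formFun_add, hB, hI, hB]
  conv_rhs => rw [← cpxRe_add_cpxIm SphereRing a, map_add, map_mul, sphereCFun_algebraMap,
    sphereCFun_algebraMap, sphereCFun_cpxI, map_add, map_mul]
  ring

lemma formFun_algebraMap (l : Module.Dual SphereRing N) :
    formFun (Algebra.linearMap SphereRing (CpxRing SphereRing) ∘ₗ l) = realFun l := by
  have h1 : cpxRe SphereRing ∘ₗ Algebra.linearMap SphereRing (CpxRing SphereRing) ∘ₗ l = l :=
    LinearMap.ext fun v => cpxRe_algebraMap SphereRing (l v)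
  -- The vanishing imaginary part is written as `0 • l` so that `realFun_smul` disposes of it.
  have h2 : cpxIm SphereRing ∘ₗ Algebra.linearMap SphereRing (CpxRing SphereRing) ∘ₗ l =
      (0 : SphereRing) • l :=
    LinearMap.ext fun v => (cpxIm_algebraMap SphereRing (l v)).trans (zero_mul (l v)).symm
  rw [formFun, h1, h2, realFun_smul, map_zero, map_zero, zero_mul, mul_zero, add_zero]

/-- The real structure fixes functions coming from the real bundle and negates `i`, so on forms it
is conjugation of values. -/
lemma canonicalReal_appTop_formFun (φ ψ : N →ₗ[SphereRing] CpxRing SphereRing)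
    (h : ∀ v, ψ v = ringConj SphereRing (φ v)) :
    (canonicalReal (bundleProj SphereRing N ≫ sphereHom)).appTop.hom (formFun φ) = formFun ψ := by
  have h1 : cpxRe SphereRing ∘ₗ ψ = cpxRe SphereRing ∘ₗ φ :=
    LinearMap.ext fun v => (congrArg _ (h v)).trans (cpxRe_ringConj SphereRing (φ v))
  have h2 : cpxIm SphereRing ∘ₗ ψ = -(cpxIm SphereRing ∘ₗ φ) :=
    LinearMap.ext fun v => (congrArg _ (h v)).trans (cpxIm_ringConj SphereRing (φ v))
  have h3 : (projC N).appTop.hom imagUnit = cpxUnit _ :=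
    cpxMap_appTop_cpxUnit sphereHom (bundleProj SphereRing N)
  rw [formFun, formFun, h1, h2, h3, map_add, map_mul, canonicalReal_appTop_cpxUnit, realFun_neg,
    realFun, realFun, canonicalReal_appTop_fst, canonicalReal_appTop_fst]
  ring

end Bundle

/-! ## Matrices acting on the trivial bundle -/

section Matrix

variable {X : Scheme.{0}}

lemma trivProj_matrixEnd (A : Matrix (Fin 2) (Fin 2) Γ(X, ⊤)) :
    matrixEnd A ≫ trivProj X = trivProj X := AffineSpace.homOfVector_over _ _

lemma matrixEnd_coord (A : Matrix (Fin 2) (Fin 2) Γ(X, ⊤)) (j : Fin 2) :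
    (matrixEnd A).appTop.hom (AffineSpace.coord X j) =
      ∑ k, (trivProj X).appTop.hom (A j k) * AffineSpace.coord X k :=
  homOfVector_coord _ _ j

lemma triv_hom_ext {Y : Scheme.{0}} {f g : Y ⟶ Triv X} (h : f ≫ trivProj X = g ≫ trivProj X)
    (h' : ∀ i, f.appTop.hom (AffineSpace.coord X i) = g.appTop.hom (AffineSpace.coord X i)) :
    f = g := AffineSpace.hom_ext h h'

lemma matrixEnd_one : matrixEnd (1 : Matrix (Fin 2) (Fin 2) Γ(X, ⊤)) = 𝟙 _ := by
  refine triv_hom_ext (by rw [trivProj_matrixEnd, Category.id_comp]) fun j => ?_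
  rw [matrixEnd_coord, Finset.sum_eq_single j]
  · rw [Matrix.one_apply_eq, map_one, one_mul]; rfl
  · intro k _ hk
    rw [Matrix.one_apply_ne hk.symm, map_zero, zero_mul]
  · simp

lemma matrixEnd_comp (A A' : Matrix (Fin 2) (Fin 2) Γ(X, ⊤)) :
    matrixEnd A ≫ matrixEnd A' = matrixEnd (A' * A) := by
  refine triv_hom_ext
    (by rw [Category.assoc, trivProj_matrixEnd, trivProj_matrixEnd, trivProj_matrixEnd])
    fun j => ?_
  have h : ∀ a, (matrixEnd A).appTop.hom ((trivProj X).appTop.hom a) = (trivProj X).appTop.hom a :=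
    fun a => by rw [← comp_appTop_apply, trivProj_matrixEnd]
  rw [comp_appTop_apply, matrixEnd_coord, matrixEnd_coord, map_sum]
  simp only [map_mul, h, matrixEnd_coord, Matrix.mul_apply, Fin.sum_univ_two, map_add]
  ring

lemma isIso_matrixEnd {A : Matrix (Fin 2) (Fin 2) Γ(X, ⊤)} (hA : IsUnit A) :
    IsIso (matrixEnd A) := by
  obtain ⟨u, rfl⟩ := hA
  exact ⟨matrixEnd (u⁻¹ : (Matrix (Fin 2) (Fin 2) Γ(X, ⊤))ˣ).1,
    by rw [matrixEnd_comp, Units.inv_mul, matrixEnd_one],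
    by rw [matrixEnd_comp, Units.mul_inv, matrixEnd_one]⟩

end Matrix

lemma Sigma0_proj : Sigma0 ≫ trivProj SphereC = trivProj SphereC ≫ canonicalReal sphereHom :=
  AffineSpace.map_over _

lemma Sigma0_coord (j : Fin 2) :
    Sigma0.appTop.hom (AffineSpace.coord SphereC j) = AffineSpace.coord SphereC j :=
  AffineSpace.map_appTop_coord _ j

lemma Sigma0_appTop_proj (a : Γ(SphereC, ⊤)) :
    Sigma0.appTop.hom ((trivProj SphereC).appTop.hom a) =
      (trivProj SphereC).appTop.hom ((canonicalReal sphereHom).appTop.hom a) := by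
  rw [← comp_appTop_apply, Sigma0_proj, comp_appTop_apply]

/-- On the coordinate functions the square acts by `A` times its conjugate, because `Σ₀` conjugates
the entries and fixes the coordinates. -/
lemma isRealStructure_comp_matrixEnd (A : Matrix (Fin 2) (Fin 2) Γ(SphereC, ⊤))
    (hA : A.map (canonicalReal sphereHom).appTop.hom * A = 1) :
    IsRealStructure trivHom (Sigma0 ≫ matrixEnd A) := by
  have hproj : (Sigma0 ≫ matrixEnd A) ≫ trivProj SphereC =
      trivProj SphereC ≫ canonicalReal sphereHom := by
    rw [Category.assoc, trivProj_matrixEnd, Sigma0_proj]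
  constructor
  · rw [← Category.assoc, hproj, Category.assoc, canonicalReal_snd, Category.assoc]
  · refine triv_hom_ext ?_ fun j => ?_
    · rw [Category.assoc, hproj, ← Category.assoc, hproj, Category.assoc, canonicalReal_comp_self,
        Category.comp_id, Category.id_comp]
    · have hc : ∀ j, (Sigma0 ≫ matrixEnd A).appTop.hom (AffineSpace.coord SphereC j) =
          ∑ k, (trivProj SphereC).appTop.hom ((A.map (canonicalReal sphereHom).appTop.hom) j k) *
            AffineSpace.coord SphereC k := by
        intro j
        rw [comp_appTop_apply, matrixEnd_coord, map_sum]
        simp only [map_mul, Sigma0_appTop_proj, Sigma0_coord, Matrix.map_apply]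
      have hs : ∀ a, (canonicalReal sphereHom).appTop.hom
          ((canonicalReal sphereHom).appTop.hom a) = a := by
        intro a
        rw [← comp_appTop_apply, canonicalReal_comp_self]; rfl
      have hp : ∀ a, (Sigma0 ≫ matrixEnd A).appTop.hom ((trivProj SphereC).appTop.hom a) =
          (trivProj SphereC).appTop.hom ((canonicalReal sphereHom).appTop.hom a) := by
        intro a
        rw [← comp_appTop_apply, hproj, comp_appTop_apply]
      -- The square of the map produces the product in the opposite order; for square matrices over
      -- a commutative ring a one-sided inverse is two-sided.
      have hA' : A * A.map (canonicalReal sphereHom).appTop.hom = 1 := mul_eq_one_comm.mp hA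
      rw [comp_appTop_apply, hc, map_sum]
      simp only [map_mul, hp, hc, Matrix.map_apply, hs]
      have key : ∀ i k, (trivProj SphereC).appTop.hom (A i 0) *
            (trivProj SphereC).appTop.hom ((canonicalReal sphereHom).appTop.hom (A 0 k)) +
          (trivProj SphereC).appTop.hom (A i 1) *
            (trivProj SphereC).appTop.hom ((canonicalReal sphereHom).appTop.hom (A 1 k)) =
          if i = k then 1 else 0 := by
        intro i k
        have := congrArg (fun D : Matrix (Fin 2) (Fin 2) Γ(SphereC, ⊤) =>
          (trivProj SphereC).appTop.hom (D i k)) hA'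
        simpa only [Matrix.mul_apply, Fin.sum_univ_two, Matrix.map_apply, map_add, map_mul,
          Matrix.one_apply, apply_ite, map_one, map_zero] using this
      rw [← matrixEnd_one, matrixEnd_coord]
      simp only [Fin.sum_univ_two, Matrix.one_apply]
      have k0 := key j 0
      have k1 := key j 1
      simp only [apply_ite (trivProj SphereC).appTop.hom, map_one, map_zero]
      linear_combination AffineSpace.coord SphereC (0 : Fin 2) * k0 +
        AffineSpace.coord SphereC (1 : Fin 2) * k1

/-! ## The trivialization of the complexified bundle -/

section Trivialization

variable {N : Type} [AddCommMonoid N] [Module SphereRing N]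
  (d : Module.Basis (Fin 2) (CpxRing SphereRing) (N →ₗ[SphereRing] CpxRing SphereRing))

/-- The complexified geometric vector bundle of `N`. -/
abbrev BundleC (N : Type) [AddCommMonoid N] [Module SphereRing N] : Scheme.{0} :=
  Cpx (bundleProj SphereRing N ≫ sphereHom)

/-- The morphism to the trivial bundle defined by the frame. -/
def frameHom : BundleC N ⟶ Triv SphereC :=
  AffineSpace.homOfVector (projC N) (fun j => formFun (d j))

lemma frameHom_proj : frameHom d ≫ trivProj SphereC = projC N :=
  AffineSpace.homOfVector_over _ _

lemma frameHom_appTop_coord (j : Fin 2) :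
    (frameHom d).appTop.hom (AffineSpace.coord SphereC j) = formFun (d j) :=
  homOfVector_coord _ _ j

lemma frameHom_appTop_proj (a : Γ(SphereC, ⊤)) :
    (frameHom d).appTop.hom ((trivProj SphereC).appTop.hom a) =
      (projC N).appTop.hom a := by
  rw [← comp_appTop_apply, frameHom_proj]

/-- The function on the trivial bundle that corresponds to a form. -/
def coefFun (φ : N →ₗ[SphereRing] CpxRing SphereRing) : Γ(Triv SphereC, ⊤) :=
  ∑ k, (trivProj SphereC).appTop.hom (sphereCFun (d.repr φ k)) *
    AffineSpace.coord SphereC k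

lemma coefFun_add (φ ψ : N →ₗ[SphereRing] CpxRing SphereRing) :
    coefFun d (φ + ψ) = coefFun d φ + coefFun d ψ := by
  simp only [coefFun, map_add, Finsupp.add_apply, add_mul, Finset.sum_add_distrib]

lemma coefFun_smul (a : CpxRing SphereRing) (φ : N →ₗ[SphereRing] CpxRing SphereRing) :
    coefFun d (a • φ) = (trivProj SphereC).appTop.hom (sphereCFun a) * coefFun d φ := by
  have h : ∀ k, d.repr (a • φ) k = a * d.repr φ k := fun k => by
    rw [map_smul, Finsupp.smul_apply, smul_eq_mul]
  simp only [coefFun, h, map_mul, Fin.sum_univ_two]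
  ring

lemma coefFun_basis (j : Fin 2) : coefFun d (d j) = AffineSpace.coord SphereC j := by
  rw [coefFun, Finset.sum_eq_single j]
  · rw [d.repr_self, Finsupp.single_eq_same, map_one, map_one, one_mul]
  · intro k _ hk
    rw [d.repr_self, Finsupp.single_eq_of_ne hk, map_zero, map_zero, zero_mul]
  · simp

lemma frameHom_appTop_coefFun (φ : N →ₗ[SphereRing] CpxRing SphereRing) :
    (frameHom d).appTop.hom (coefFun d φ) = formFun φ := by
  have h := d.sum_repr φ
  rw [Fin.sum_univ_two] at h
  rw [coefFun, Fin.sum_univ_two, map_add, map_mul, map_mul, frameHom_appTop_proj,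
    frameHom_appTop_proj, frameHom_appTop_coord, frameHom_appTop_coord, ← formFun_smul,
    ← formFun_smul, ← formFun_add, h]

/-- A real form as a complex valued form. -/
def realForm (l : Module.Dual SphereRing N) : N →ₗ[SphereRing] CpxRing SphereRing :=
  Algebra.linearMap SphereRing (CpxRing SphereRing) ∘ₗ l

/-- The inverse morphism is prescribed only on real forms; this decomposition determines it on all
complex valued forms. -/
lemma realForm_re_add_im (φ : N →ₗ[SphereRing] CpxRing SphereRing) :
    φ = realForm (cpxRe SphereRing ∘ₗ φ) +
      cpxI SphereRing • realForm (cpxIm SphereRing ∘ₗ φ) :=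
  LinearMap.ext fun v => (cpxRe_add_cpxIm SphereRing (φ v)).symm

lemma realForm_smul (b : SphereRing) (l : Module.Dual SphereRing N) :
    realForm (b • l) = algebraMap SphereRing (CpxRing SphereRing) b • realForm l :=
  LinearMap.ext fun v => map_mul (algebraMap SphereRing (CpxRing SphereRing)) b (l v)

/-- The homomorphism from the symmetric algebra to the functions on the trivial bundle. -/
def frameInvRingHom :
    SymmetricAlgebra SphereRing (Module.Dual SphereRing N) →+*
      Γ(Triv SphereC, ⊤) :=
  symLift ((trivProj SphereC).appTop.hom.comp sphereFun) (fun l => coefFun d (realForm l))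
    (fun l l' => by
      rw [← coefFun_add, realForm, LinearMap.comp_add]; rfl)
    (fun b l => by
      rw [realForm_smul, coefFun_smul, sphereCFun_algebraMap]; rfl)

/-- The morphism from the trivial bundle to the real geometric vector bundle. -/
def frameInvReal : Triv SphereC ⟶ BundleOf SphereRing N :=
  homToSpec (frameInvRingHom d)

lemma frameInvReal_appTop_bundleForm (l : Module.Dual SphereRing N) :
    (frameInvReal d).appTop.hom (bundleForm SphereRing _ l) = coefFun d (realForm l) :=
  (homToSpec_appTop_apply _ _).trans (symLift_ι _ _ _ _ l)

lemma frameInvReal_proj :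
    frameInvReal d ≫ bundleProj SphereRing N =
      trivProj SphereC ≫ cpxFst sphereHom := by
  refine hom_Spec_ext fun b => ?_
  rw [comp_appTop_apply, comp_appTop_apply, bundleProj, SpecMap_appTop_apply]
  exact (homToSpec_appTop_apply _ _).trans (symLift_algebraMap _ _ _ _ b)

/-- The inverse of the morphism defined by the frame. -/
def frameInv : Triv SphereC ⟶ BundleC N :=
  pullback.lift (frameInvReal d) trivHom (by
    rw [← Category.assoc, frameInvReal_proj, Category.assoc, Category.assoc]
    exact congrArg (fun f => trivProj SphereC ≫ f) pullback.condition)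

lemma frameInv_fst : frameInv d ≫ cpxFst _ = frameInvReal d := pullback.lift_fst _ _ _

lemma frameInv_snd : frameInv d ≫ cpxSnd _ = trivHom := pullback.lift_snd _ _ _

lemma frameInv_proj : frameInv d ≫ projC N = trivProj SphereC := by
  apply pullback.hom_ext
  · rw [Category.assoc, cpxMap_fst, ← Category.assoc, frameInv_fst, frameInvReal_proj]
  · rw [Category.assoc, cpxMap_snd, frameInv_snd]

lemma frameInv_appTop_projC (a : Γ(SphereC, ⊤)) :
    (frameInv d).appTop.hom ((projC N).appTop.hom a) =
      (trivProj SphereC).appTop.hom a := by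
  rw [← comp_appTop_apply, frameInv_proj]

lemma frameInv_appTop_realFun (l : Module.Dual SphereRing N) :
    (frameInv d).appTop.hom (realFun l) = coefFun d (realForm l) := by
  rw [realFun, ← comp_appTop_apply, frameInv_fst, frameInvReal_appTop_bundleForm]

lemma frameInv_appTop_formFun (φ : N →ₗ[SphereRing] CpxRing SphereRing) :
    (frameInv d).appTop.hom (formFun φ) = coefFun d φ := by
  conv_rhs => rw [realForm_re_add_im φ, coefFun_add, coefFun_smul, sphereCFun_cpxI]
  rw [formFun, map_add, map_mul, frameInv_appTop_projC, frameInv_appTop_realFun,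
    frameInv_appTop_realFun]

/-- The isomorphism onto the trivial bundle defined by the frame. -/
def frameIso : BundleC N ≅ Triv SphereC where
  hom := frameHom d
  inv := frameInv d
  hom_inv_id := by
    apply pullback.hom_ext
    · rw [Category.assoc, frameInv_fst, Category.id_comp]
      refine hom_Spec_ext fun a => ?_
      let e := (Scheme.ΓSpecIso (.of (SymmetricAlgebra SphereRing
        (Module.Dual SphereRing N)))).inv.hom
      -- Two morphisms to the affine scheme `BundleOf SphereRing N` agree once they agree on
      -- functions from the base and on linear forms, which generate the symmetric algebra.
      have h : (frameHom d ≫ frameInvReal d).appTop.hom.comp e = (cpxFst _).appTop.hom.comp e := by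
        refine symmetricAlgebra_hom_ext (fun b => ?_) (fun l => ?_)
        · change (frameHom d ≫ frameInvReal d).appTop.hom (e _) = (cpxFst _).appTop.hom (e _)
          rw [comp_appTop_apply]
          refine (congrArg _ ((homToSpec_appTop_apply _ _).trans
            (symLift_algebraMap _ _ _ _ b))).trans ?_
          exact (frameHom_appTop_proj d _).trans (projC_appTop_sphereFun b)
        · change (frameHom d ≫ frameInvReal d).appTop.hom (bundleForm SphereRing _ l) = realFun l
          rw [comp_appTop_apply, frameInvReal_appTop_bundleForm, frameHom_appTop_coefFun, realForm,
            formFun_algebraMap]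
      exact congrArg (fun g => g a) h
    · rw [Category.assoc, frameInv_snd, Category.id_comp, ← Category.assoc, frameHom_proj,
        cpxMap_snd]
  inv_hom_id := by
    refine triv_hom_ext ?_ fun j => ?_
    · rw [Category.assoc, frameHom_proj, frameInv_proj, Category.id_comp]
    · rw [comp_appTop_apply, frameHom_appTop_coord, frameInv_appTop_formFun, coefFun_basis]
      rfl

variable (N) in
/-- The fibrewise linear functions on the complexified bundle. -/
abbrev bundleLinear : AddSubgroup Γ(BundleC N, ⊤) :=
  linSpan (projC N) (Set.range fun l => realFun l)

lemma mul_mem_linSpan {V X : Scheme.{0}} (p : V ⟶ X) {S : Set Γ(V, ⊤)} (a : Γ(X, ⊤))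
    {g : Γ(V, ⊤)} (hg : g ∈ S) : p.appTop.hom a * g ∈ linSpan p S :=
  AddSubgroup.subset_closure ⟨a, g, hg, rfl⟩

lemma mul_mem_linSpan_of_mem {V X : Scheme.{0}} (p : V ⟶ X) {S : Set Γ(V, ⊤)} (a : Γ(X, ⊤))
    {g : Γ(V, ⊤)} (hg : g ∈ linSpan p S) : p.appTop.hom a * g ∈ linSpan p S := by
  induction hg using AddSubgroup.closure_induction with
  | mem x hx =>
    obtain ⟨b, s, hs, rfl⟩ := hx
    rw [← mul_assoc, ← map_mul]
    exact mul_mem_linSpan p _ hs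
  | zero => rw [mul_zero]; exact zero_mem _
  | add x y _ _ hx hy => rw [mul_add]; exact add_mem hx hy
  | neg x _ hx => rw [mul_neg]; exact neg_mem hx

lemma formFun_mem (φ : N →ₗ[SphereRing] CpxRing SphereRing) : formFun φ ∈ bundleLinear N := by
  refine add_mem ?_ (mul_mem_linSpan _ _ ⟨_, rfl⟩)
  have := mul_mem_linSpan (projC N)
    (S := Set.range fun l => realFun l) 1 ⟨cpxRe SphereRing ∘ₗ φ, rfl⟩
  rwa [map_one, one_mul] at this

lemma coefFun_mem (φ : N →ₗ[SphereRing] CpxRing SphereRing) : coefFun d φ ∈ trivLinear SphereC :=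
  sum_mem fun _ _ => mul_mem_linSpan _ _ ⟨_, rfl⟩

lemma appTop_mem_linSpan {V W X : Scheme.{0}} {p : V ⟶ X} {q : W ⟶ X} {f : V ⟶ W}
    (hf : f ≫ q = p) {S : Set Γ(V, ⊤)} {T : Set Γ(W, ⊤)}
    (h : ∀ t ∈ T, f.appTop.hom t ∈ linSpan p S) :
    ∀ g ∈ linSpan q T, f.appTop.hom g ∈ linSpan p S := by
  intro g hg
  induction hg using AddSubgroup.closure_induction with
  | mem x hx =>
    obtain ⟨b, s, hs, rfl⟩ := hx
    rw [map_mul, ← comp_appTop_apply, hf]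
    exact mul_mem_linSpan_of_mem p _ (h s hs)
  | zero => rw [map_zero]; exact zero_mem _
  | add x y _ _ hx hy => rw [map_add]; exact add_mem hx hy
  | neg x _ hx => rw [map_neg]; exact neg_mem hx

lemma isBundleIso_frameIso :
    IsBundleIso (projC N) (trivProj SphereC) (bundleLinear N)
      (trivLinear SphereC) (frameIso d) where
  isOver := frameHom_proj d
  hom_linear := appTop_mem_linSpan (frameHom_proj d) (by
    rintro _ ⟨j, rfl⟩
    exact (frameHom_appTop_coord d j).symm ▸ formFun_mem _)
  inv_linear := appTop_mem_linSpan (frameInv_proj d) (by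
    rintro _ ⟨l, rfl⟩
    exact (frameInv_appTop_realFun d l).symm ▸ coefFun_mem d _)

/-- Both sides lie over the real structure of the sphere, so only the pull-backs of the two
coordinates matter. The left side gives the frame transformed by the conjugate of `A`, since `Σ₀` is
applied before the matrix; the right side gives the conjugated frame. -/
lemma frameHom_comp_matrixEnd (A : Matrix (Fin 2) (Fin 2) (CpxRing SphereRing))
    (hA : ∀ j v, ringConj SphereRing (d j v) =
      ringConj SphereRing (A j 0) * d 0 v + ringConj SphereRing (A j 1) * d 1 v) :
    frameHom d ≫ Sigma0 ≫ matrixEnd (A.map sphereCFun) =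
      canonicalReal (bundleProj SphereRing N ≫ sphereHom) ≫ frameHom d := by
  refine triv_hom_ext ?_ fun j => ?_
  · rw [Category.assoc, Category.assoc, trivProj_matrixEnd, Sigma0_proj, Category.assoc,
      frameHom_proj, ← Category.assoc, frameHom_proj, canonicalReal_cpxMap]
  · rw [comp_appTop_apply, comp_appTop_apply, comp_appTop_apply, frameHom_appTop_coord,
      matrixEnd_coord, Fin.sum_univ_two, map_add, map_mul, map_mul, Sigma0_appTop_proj,
      Sigma0_appTop_proj, Sigma0_coord, Sigma0_coord, map_add, map_mul, map_mul,
      frameHom_appTop_proj, frameHom_appTop_proj, frameHom_appTop_coord, frameHom_appTop_coord,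
      Matrix.map_apply, Matrix.map_apply, canonicalReal_appTop_sphereCFun,
      canonicalReal_appTop_sphereCFun, ← formFun_smul, ← formFun_smul, ← formFun_add]
    exact (canonicalReal_appTop_formFun _ _ fun v => (hA j v).symm).symm

end Trivialization

/-- The frame of a hermitian pair, as a basis. -/
def HermitianPair.basis {M : Type} [AddCommGroup M] [Module (CpxRing SphereRing) M]
    (d : HermitianPair SphereRing M) :
    Module.Basis (Fin 2) (CpxRing SphereRing) (CpxForms SphereRing M) :=
  Module.Basis.ofEquivFun
    { toFun := fun φ k => cpxHalf * d.coef k φ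
      map_add' := fun φ ψ => by
        funext k
        rw [map_add, mul_add]; rfl
      map_smul' := fun a φ => by
        funext k
        rw [map_smul, smul_eq_mul, mul_left_comm]; rfl
      invFun := fun c => c 0 • d.frame 0 + c 1 • d.frame 1
      left_inv := fun φ => by
        refine LinearMap.ext fun v => ?_
        change cpxHalf * d.coef 0 φ * d.frame 0 v + cpxHalf * d.coef 1 φ * d.frame 1 v = φ v
        linear_combination -cpxHalf * d.two_mul_form φ v + φ v * two_mul_cpxHalf
      right_inv := fun c => by
        funext k
        change cpxHalf * d.coef k (c 0 • d.frame 0 + c 1 • d.frame 1) = c k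
        rw [map_add, map_smul, map_smul, d.coef_frame, d.coef_frame]
        fin_cases k
        · change cpxHalf * (c 0 * 2 + c 1 * 0) = c 0
          linear_combination c 0 * two_mul_cpxHalf
        · change cpxHalf * (c 0 * 0 + c 1 * 2) = c 1
          linear_combination c 1 * two_mul_cpxHalf }

lemma HermitianPair.basis_apply {M : Type} [AddCommGroup M] [Module (CpxRing SphereRing) M]
    (d : HermitianPair SphereRing M) (j : Fin 2) : d.basis j = d.frame j := by
  rw [HermitianPair.basis, Module.Basis.coe_ofEquivFun]
  refine LinearMap.ext fun v => ?_
  change (Pi.single j 1 : Fin 2 → CpxRing SphereRing) 0 * d.frame 0 v +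
    (Pi.single j 1 : Fin 2 → CpxRing SphereRing) 1 * d.frame 1 v = d.frame j v
  fin_cases j <;> simp

lemma HermitianPair.frameHom_comp_matrixEnd {M : Type} [AddCommGroup M]
    [Module (CpxRing SphereRing) M] (d : HermitianPair SphereRing M)
    (A : Matrix (Fin 2) (Fin 2) (CpxRing SphereRing))
    (hA : A.map (ringConj SphereRing) =
      !![d.g 1 (d.s 0) * (d.c 0 + d.c 1), d.g 1 (d.s 1) - d.g 0 (d.s 0);
        -(d.g 0 (d.s 0) * d.c 0 ^ 2) + d.g 1 (d.s 1) * d.c 1 ^ 2,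
        -(d.g 0 (d.s 1) * (d.c 0 + d.c 1))]) :
    frameHom d.basis ≫ Sigma0 ≫ matrixEnd (A.map sphereCFun) =
      canonicalReal (bundleProj SphereRing (descent SphereRing M) ≫ sphereHom) ≫
        frameHom d.basis := by
  refine RealSphere.frameHom_comp_matrixEnd d.basis A fun j v => ?_
  have e : ∀ i j, ringConj SphereRing (A i j) = _ := fun i j => congrArg (fun D => D i j) hA
  rw [d.basis_apply, d.basis_apply, d.basis_apply, e, e]
  fin_cases j
  · exact d.conj_frame_zero v
  · exact d.conj_frame_one v

/-! ## The matrix `A_n` -/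

/-- The value of a real polynomial at the coordinate `z`. -/
def polyZ (P : Polynomial ℝ) : CpxRing SphereRing :=
  algebraMap SphereRing (CpxRing SphereRing) (Polynomial.aeval (sphereCoord 2) P)

lemma ringConj_polyZ (P : Polynomial ℝ) : ringConj SphereRing (polyZ P) = polyZ P :=
  ringConj_algebraMap _ _

lemma polyZ_unity {n : ℕ} {P Q : Polynomial ℝ}
    (h : (1 + Polynomial.X) ^ n * P + (1 - Polynomial.X) ^ n * Q = 1) :
    (1 + cpxCoord 2) ^ n * polyZ P + (1 - cpxCoord 2) ^ n * polyZ Q = 1 := by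
  have h' := congrArg (fun F => algebraMap SphereRing (CpxRing SphereRing)
    (Polynomial.aeval (sphereCoord 2) F)) h
  simp only [map_add, map_mul, map_pow, map_sub, map_one, Polynomial.aeval_X] at h'
  exact h'

/-- The matrix `A_n` with entries in the coordinate ring. -/
def cpxMatA (n : ℕ) (P Q : Polynomial ℝ) : Matrix (Fin 2) (Fin 2) (CpxRing SphereRing) :=
  !![coordMinus ^ n * (polyZ P + polyZ Q), (1 - cpxCoord 2) ^ n - (1 + cpxCoord 2) ^ n;
     -((1 + cpxCoord 2) ^ n * polyZ P ^ 2) + (1 - cpxCoord 2) ^ n * polyZ Q ^ 2,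
     -(coordPlus ^ n * (polyZ P + polyZ Q))]

lemma sphereCFun_cpxCoord (i : Fin 3) :
    sphereCFun (cpxCoord i) = sphereFun (sphereCoord i) := sphereCFun_algebraMap _

lemma sphereCFun_polyZ (P : Polynomial ℝ) :
    sphereCFun (polyZ P) = sphereFun (Polynomial.aeval (sphereCoord 2) P) :=
  sphereCFun_algebraMap _

lemma map_cpxMatA (n : ℕ) (P Q : Polynomial ℝ) :
    (cpxMatA n P Q).map sphereCFun = matA n P Q := by
  ext i j
  fin_cases i <;> fin_cases j <;>
    simp [cpxMatA, matA, coordPlus, coordMinus, sphereCFun_cpxCoord, sphereCFun_polyZ,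
      sphereCFun_cpxI]

lemma map_conj_cpxMatA (n : ℕ) (P Q : Polynomial ℝ) :
    (cpxMatA n P Q).map (ringConj SphereRing) =
      !![coordPlus ^ n * (polyZ P + polyZ Q), (1 - cpxCoord 2) ^ n - (1 + cpxCoord 2) ^ n;
        -((1 + cpxCoord 2) ^ n * polyZ P ^ 2) + (1 - cpxCoord 2) ^ n * polyZ Q ^ 2,
        -(coordMinus ^ n * (polyZ P + polyZ Q))] := by
  ext i j
  fin_cases i <;> fin_cases j <;>
    simp [cpxMatA, ringConj_coordPlus, ringConj_coordMinus, ringConj_polyZ, ringConj_cpxCoord]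

lemma conj_cpxMatA_mul_cpxMatA {n : ℕ} {P Q : Polynomial ℝ}
    (h : (1 + Polynomial.X) ^ n * P + (1 - Polynomial.X) ^ n * Q = 1) :
    (cpxMatA n P Q).map (ringConj SphereRing) * cpxMatA n P Q = 1 := by
  have h1 := polyZ_unity h
  have h2 : coordPlus ^ n * coordMinus ^ n = (1 + cpxCoord 2) ^ n * (1 - cpxCoord 2) ^ n := by
    rw [← mul_pow, ← mul_pow, coordPlus_mul_coordMinus]
  rw [map_conj_cpxMatA, cpxMatA, Matrix.mul_fin_two, Matrix.one_fin_two]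
  generalize coordPlus ^ n = w at *
  generalize coordMinus ^ n = w' at *
  generalize (1 + cpxCoord 2) ^ n = u at *
  generalize (1 - cpxCoord 2) ^ n = s at *
  generalize polyZ P = p at *
  generalize polyZ Q = r at *
  -- Once `w * w'` is replaced by `u * s`, the left side is `(u * p + s * r) ^ 2`. Both diagonal
  -- entries reduce to this identity; the off-diagonal ones cancel formally.
  have e : w * (p + r) * (w' * (p + r)) + (s - u) * (-(u * p ^ 2) + s * r ^ 2) = 1 := by
    linear_combination (p + r) ^ 2 * h2 + (u * p + s * r + 1) * h1
  congr 1
  congr 1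
  · exact congrArg₂ _ e (congrArg₂ _ (by ring) rfl)
  · exact congrArg₂ _ (congrArg₂ _ (by ring)
      (congrArg₂ _ (by linear_combination e) rfl)) rfl

lemma conj_matA_mul_matA {n : ℕ} {P Q : Polynomial ℝ}
    (h : (1 + Polynomial.X) ^ n * P + (1 - Polynomial.X) ^ n * Q = 1) :
    (matA n P Q).map (canonicalReal sphereHom).appTop.hom * matA n P Q = 1 := by
  have e : (matA n P Q).map (canonicalReal sphereHom).appTop.hom =
      ((cpxMatA n P Q).map (ringConj SphereRing)).map sphereCFun := by
    ext i j
    rw [← map_cpxMatA]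
    exact canonicalReal_appTop_sphereCFun _
  rw [e, ← map_cpxMatA, ← Matrix.map_mul, conj_cpxMatA_mul_cpxMatA h]
  exact Matrix.map_one _ (map_zero _) (map_one _)

/-! ## The vector bundle `V_n` -/

/-- The sections `x_i^n` and the forms `(2 y_j)^n / T^n` on `L_n`. -/
def linePair {n : ℕ} {P Q : Polynomial ℝ}
    (h : (1 + Polynomial.X) ^ n * P + (1 - Polynomial.X) ^ n * Q = 1) :
    HermitianPair SphereRing (lineSections n) where
  s := linePow n
  g := lineCoord n
  c := ![polyZ P, polyZ Q]
  conj_c i := by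
    fin_cases i
    · exact ringConj_polyZ P
    · exact ringConj_polyZ Q
  conj_g i j := by
    fin_cases i <;> fin_cases j <;>
      simp only [Fin.zero_eta, Fin.mk_one, lineCoord_zero_linePow_zero, lineCoord_zero_linePow_one,
        lineCoord_one_linePow_zero, lineCoord_one_linePow_one, map_pow, ringConj_coordPlus,
        ringConj_coordMinus, map_add, map_sub, map_one, ringConj_cpxCoord]
  comm i j k m := by
    -- In the localization each form is multiplication by a fixed element, so the rank one relation
    -- becomes commutativity.
    apply quadPull_injective
    simp only [map_mul, quadPull_lineCoord]
    ring
  unity := by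
    rw [lineCoord_zero_linePow_zero, lineCoord_one_linePow_one]
    simp only [Matrix.cons_val_zero, Matrix.cons_val_one]
    linear_combination polyZ_unity h
  expansion := lineSections_expansion (polyZ_unity h)

lemma map_conj_cpxMatA_eq_linePair {n : ℕ} {P Q : Polynomial ℝ}
    (h : (1 + Polynomial.X) ^ n * P + (1 - Polynomial.X) ^ n * Q = 1) :
    (cpxMatA n P Q).map (ringConj SphereRing) =
      !![(linePair h).g 1 ((linePair h).s 0) * ((linePair h).c 0 + (linePair h).c 1),
          (linePair h).g 1 ((linePair h).s 1) - (linePair h).g 0 ((linePair h).s 0);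
        -((linePair h).g 0 ((linePair h).s 0) * (linePair h).c 0 ^ 2)
            + (linePair h).g 1 ((linePair h).s 1) * (linePair h).c 1 ^ 2,
          -((linePair h).g 0 ((linePair h).s 1) * ((linePair h).c 0 + (linePair h).c 1))] := by
  have h00 : (linePair h).g 0 ((linePair h).s 0) = _ := lineCoord_zero_linePow_zero n
  have h01 : (linePair h).g 0 ((linePair h).s 1) = _ := lineCoord_zero_linePow_one n
  have h10 : (linePair h).g 1 ((linePair h).s 0) = _ := lineCoord_one_linePow_zero n
  have h11 : (linePair h).g 1 ((linePair h).s 1) = _ := lineCoord_one_linePow_one n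
  rw [map_conj_cpxMatA, h00, h01, h10, h11]
  rfl

end RealSphere

end

theorem mainTheorem7 (n : ℕ) (hn : 1 ≤ n) (P Q : Polynomial ℝ)
    (hPQ : (1 + Polynomial.X) ^ n * P + (1 - Polynomial.X) ^ n * Q = 1) :
    (IsUnit (RealSphere.matA n P Q) ∧
      IsIso (RealSphere.matrixEnd (RealSphere.matA n P Q)) ∧
      RealSphere.IsRealStructure RealSphere.trivHom (RealSphere.SigmaN n P Q)) ∧
    ∃ Θ : RealSphere.VC n ≅ RealSphere.Triv RealSphere.SphereC,
      RealSphere.IsBundleIso (RealSphere.qC n) (RealSphere.trivProj RealSphere.SphereC)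
        (RealSphere.VCLinear n) (RealSphere.trivLinear RealSphere.SphereC) Θ ∧
      Θ.hom ≫ RealSphere.SigmaN n P Q = RealSphere.sigmaV n ≫ Θ.hom := by
  -- This single identity gives the invertibility of the matrix and the involutivity of `Σ_n`.
  have hA := RealSphere.conj_matA_mul_matA hPQ
  have hu : IsUnit (RealSphere.matA n P Q) := IsUnit.of_mul_eq_one_right _ hA
  refine ⟨⟨hu, RealSphere.isIso_matrixEnd hu, RealSphere.isRealStructure_comp_matrixEnd _ hA⟩,
    RealSphere.frameIso (RealSphere.linePair hPQ).basis,
    RealSphere.isBundleIso_frameIso _, ?_⟩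
  have key := (RealSphere.linePair hPQ).frameHom_comp_matrixEnd (RealSphere.cpxMatA n P Q)
    (RealSphere.map_conj_cpxMatA_eq_linePair hPQ)
  rw [RealSphere.map_cpxMatA] at key
  exact key
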